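/- A plane partition in an $a\times b\times c$ box is a set $P$ of unit cubes of the box $[0,a]\times[0,b]\times[0,c]$ such that, with every cube of $P$, all cubes of the box weakly below, behind and to the left of it also belong to $P$. A cube is denoted by the coordinates $(x,y,z)$ of its corner farthest from the origin, so $1\le x\le a$, $1\le y\le b$, $1\le z\le c$. When cubes are given weights, the weight of $P$ is the product of the weights of its cubes. $P$ is self-complementary if for every cube $(x,y,z)$ of the box exactly one of $(x,y,z)$ and $(a+1-x,b+1-y,c+1-z)$ belongs to $P$; if $a=b=c$, $P$ is cyclically symmetric if it is invariant under $(x,y,z)\mapsto(y,z,x)$. Let $N_1(2a,2b,2c)_{-1,1}$ be the sum of the weights of all plane partitions in a $2a\times 2b\times 2c$ box, where the cubes $(a+i,b+i,c+i)$, $i\in\mathbb{Z}$, have weight $-1$ and all other cubes have weight $1$. Let $N_5(2a,2b,2c)$ be the number of self-complementary plane partitions in this box. Let $N_3(2a,2a,2a)_{-1,1,1}$ be the sum of the weights of all cyclically symmetric plane partitions in a $2a\times 2a\times 2a$ box, where the cubes $(i,i,i)$ have weight $-1$ and all other cubes have weight $1$. Let $N_9(2a,2a,2a)$ be the number of plane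 partitions in this box that are both cyclically symmetric and self-complementary. Then for all non-negative integers $a,b,c$ $$|N_1(2a,2b,2c)_{-1,1}| = N_5(2a,2b,2c)^2 \qquad\text{and}\qquad |N_3(2a,2a,2a)_{-1,1,1}| = N_9(2a,2a,2a)^2 .$$ -/

import Mathlib

namespace BoxPP

/-- The unit cubes of an `a × b × c` box; a cube is denoted by the (positive integer) coordinates of
its corner farthest from the origin. -/
def box (a b c : ℕ) : Finset (ℕ × ℕ × ℕ) :=
  Finset.Icc 1 a ×ˢ Finset.Icc 1 b ×ˢ Finset.Icc 1 c

/-- A plane partition in an `a × b × c` box: a set `P` of unit cubes of the box such that every cube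
of the box that is weakly below, behind and to the left of a cube of `P` belongs to `P`. -/
def IsPlanePartition (a b c : ℕ) (P : Finset (ℕ × ℕ × ℕ)) : Prop :=
  P ⊆ box a b c ∧ ∀ p ∈ P, ∀ q ∈ box a b c, q ≤ p → q ∈ P

/-- `P` is cyclically symmetric: it is invariant under the rotation of order three
`(x, y, z) ↦ (y, z, x)`. -/
def IsCyclicallySymmetric (P : Finset (ℕ × ℕ × ℕ)) : Prop :=
  ∀ x y z : ℕ, (x, y, z) ∈ P ↔ (y, z, x) ∈ P

/-- `P` is self-complementary in the `a × b × c` box: a cube belongs to `P` exactly when its image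
under the point reflection in the centre of the box does not. -/
def IsSelfComplementary (a b c : ℕ) (P : Finset (ℕ × ℕ × ℕ)) : Prop :=
  ∀ x y z : ℕ, (x, y, z) ∈ box a b c →
    ((x, y, z) ∈ P ↔ (a + 1 - x, b + 1 - y, c + 1 - z) ∉ P)

open Classical in
/-- All plane partitions in an `a × b × c` box. -/
noncomputable def planePartitions (a b c : ℕ) : Finset (Finset (ℕ × ℕ × ℕ)) :=
  (box a b c).powerset.filter (IsPlanePartition a b c)

open Classical in
/-- `N₁(2a, 2b, 2c)_{s,t}`: the weighted enumeration of the plane partitions in a `2a × 2b × 2c` box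
in which the cubes `(a + i, b + i, c + i)`, for `i` an integer, have weight `s` and all other cubes
have weight `t`; the weight of a plane partition is the product of the weights of its cubes. -/
noncomputable def N1 (a b c : ℕ) (s t : ℤ) : ℤ :=
  ∑ P ∈ planePartitions (2 * a) (2 * b) (2 * c), ∏ p ∈ P,
    if ∃ i : ℤ, (p.1 : ℤ) = a + i ∧ (p.2.1 : ℤ) = b + i ∧ (p.2.2 : ℤ) = c + i then s else t

open Classical in
/-- `N₃(n, n, n)_{s,t,u}`: the weighted enumeration of the cyclically symmetric plane partitions in an
`n × n × n` box in which a cube has weight `s`, `t` or `u` according to whether its three coordinates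
are all equal, exactly two of them are equal, or all are different. -/
noncomputable def N3 (n : ℕ) (s t u : ℤ) : ℤ :=
  ∑ P ∈ (planePartitions n n n).filter IsCyclicallySymmetric, ∏ p ∈ P,
    if p.1 = p.2.1 ∧ p.2.1 = p.2.2 then s
    else if p.1 ≠ p.2.1 ∧ p.2.1 ≠ p.2.2 ∧ p.1 ≠ p.2.2 then u
    else t

open Classical in
/-- `N₅(a, b, c)`: the number of self-complementary plane partitions in an `a × b × c` box. -/
noncomputable def N5 (a b c : ℕ) : ℕ :=
  ((planePartitions a b c).filter (IsSelfComplementary a b c)).card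

open Classical in
/-- `N₉(n, n, n)`: the number of cyclically symmetric self-complementary plane partitions in an
`n × n × n` box. -/
noncomputable def N9 (n : ℕ) : ℕ :=
  ((planePartitions n n n).filter
    (fun P => IsCyclicallySymmetric P ∧ IsSelfComplementary n n n P)).card

end BoxPP

/-! Both identities are proved at once for a subgroup `G` of the rotations of order three: `G = ⊥`
gives the first, `G = ⊤` the second. In coordinates centred in the box, projection along the main
diagonal turns a plane partition into a lozenge tiling of a hexagon, i.e. a perfect matching between
its two kinds of triangles: those of coordinate sum `-1`, with corners `t + unitVec j`, and their
images under the point reflection. Labelling each triangle of the second kind by its reflection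
makes the signed bipartite adjacency matrix square; dividing by `G` gives the matrix of `net`.

The signs `wt` have two properties. They are odd under the reflection (`wt_nbr`), so the matrix is
skew-symmetric; and the product of the six signs around a lattice point is `1`, except at the
centre, where it is `-1` (`wt_flux`). The determinant is then computed in two ways.

As a sum over matchings (`SkewNet.det_adj`): adding an orbit of cubes turns the matching around one
orbit of lattice points. This is a three-cycle, hence even, so the term changes by the flux alone
(at the centre with `G = ⊤` the cycle collapses to a point, but the factor is still `-1`). Thus the
sign changes exactly for cubes on the main diagonal (`det_secMat_flip`, `det_secMat_sec`), and the
determinant is the weighted count up to a global sign.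

As the square of a Pfaffian (`rawPf_sq`): the Pfaffian is a sum over matchings invariant under the
reflection, which are the self-complementary plane partitions (`sec_mem_symMatchings_iff`). Any two
of them are linked by exchanging orbits of cubes for the opposite orbits, always away from the main
diagonal, and each exchange is a congruence by a matrix of determinant one (`exists_congr_flip`,
`exists_congr_sec`). So all terms agree and the determinant is the square of their number
(`SkewNet.det_adj_eq_sq`). `abs_sum_invPP` compares the two results. -/

namespace BoxPP

/-! ### Pfaffians over the rationals, up to a normalising constant. -/

open Finset Matrix

/-- A multiple of the Pfaffian of a matrix of even size: the sum over all ways to arrange the index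
set as a sequence of ordered pairs. -/
def rawPf {m : ℕ} (X : Matrix (Fin 2 × Fin m) (Fin 2 × Fin m) ℚ) : ℚ :=
  ∑ σ : Equiv.Perm (Fin 2 × Fin m),
    ((Equiv.Perm.sign σ : ℤ) : ℚ) * ∏ j, X (σ (0, j)) (σ (1, j))

/-- The block diagonal standard skew-symmetric matrix. -/
def stdSkew (m : ℕ) : Matrix (Fin 2 × Fin m) (Fin 2 × Fin m) ℚ :=
  Matrix.blockDiagonal fun _ => !![0, 1; -1, 0]

theorem det_submatrix_of_not_injective {ι : Type*} [Fintype ι] [DecidableEq ι]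
    (A : Matrix ι ι ℚ) (G : ι → ι) (hG : ¬ Function.Injective G) :
    (A.submatrix id G).det = 0 := by
  simp only [Function.Injective, not_forall] at hG
  obtain ⟨x, y, hxy, hne⟩ := hG
  exact Matrix.det_zero_of_column_eq hne (fun k => by simp [hxy])

/-- Expanding every entry of the congruent matrix gives a sum over choices `h` of an index pair for
each `j`. The sum over `σ` then assembles to the determinant of `A` with columns selected by `h`. It
vanishes unless the selection is a permutation, and for a permutation it is `A.det` up to sign. -/
theorem rawPf_congr {m : ℕ} (A X : Matrix (Fin 2 × Fin m) (Fin 2 × Fin m) ℚ) :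
    rawPf (A * X * Aᵀ) = A.det * rawPf X := by
  have entry : ∀ i i', (A * X * Aᵀ) i i' =
      ∑ p : (Fin 2 × Fin m) × (Fin 2 × Fin m), A i p.1 * X p.1 p.2 * A i' p.2 := by
    intro i i'
    rw [Fintype.sum_prod_type_right (f := fun p : (Fin 2 × Fin m) × (Fin 2 × Fin m) =>
      A i p.1 * X p.1 p.2 * A i' p.2), Matrix.mul_apply]
    refine Finset.sum_congr rfl fun k _ => ?_
    rw [Matrix.mul_apply, Finset.sum_mul, Matrix.transpose_apply]
  let Q : (Fin m → (Fin 2 × Fin m) × (Fin 2 × Fin m)) → Fin 2 × Fin m → Fin 2 × Fin m :=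
    fun h y => if y.1 = 0 then (h y.2).1 else (h y.2).2
  have hdet : ∀ h, (A.submatrix id (Q h)).det =
      ∑ σ : Equiv.Perm (Fin 2 × Fin m), ((Equiv.Perm.sign σ : ℤ) : ℚ) *
        ∏ j, (A (σ (0, j)) (h j).1 * A (σ (1, j)) (h j).2) := by
    intro h
    rw [Matrix.det_apply']
    refine Finset.sum_congr rfl fun σ _ => ?_
    rw [Fintype.prod_prod_type]
    simp [Q, Fin.prod_univ_two, Finset.prod_mul_distrib]
  have hL : rawPf (A * X * Aᵀ) = ∑ h : Fin m → (Fin 2 × Fin m) × (Fin 2 × Fin m),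
      (∏ j, X (h j).1 (h j).2) * (A.submatrix id (Q h)).det := by
    simp only [rawPf, entry, Finset.prod_univ_sum, Fintype.piFinset_univ, Finset.mul_sum, hdet]
    rw [Finset.sum_comm]
    refine Finset.sum_congr rfl fun h _ => Finset.sum_congr rfl fun σ _ => ?_
    simp only [Finset.prod_mul_distrib]
    ring
  rw [hL, rawPf, Finset.mul_sum]
  symm
  refine Finset.sum_of_injOn (fun σ j => (σ (0, j), σ (1, j))) ?_ (by simp) ?_ ?_
  · intro σ _ τ _ h
    ext1 ⟨b, j⟩
    have := congrFun h j
    simp only [Prod.mk.injEq] at this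
    fin_cases b
    · exact this.1
    · exact this.2
  · intro h _ hh
    rw [det_submatrix_of_not_injective, mul_zero]
    intro hinj
    apply hh
    refine ⟨Equiv.ofBijective (Q h) (Finite.injective_iff_bijective.mp hinj), by simp, ?_⟩
    funext j
    simp [Q]
  · intro σ _
    have : Q (fun j => (σ (0, j), σ (1, j))) = σ := by
      funext ⟨b, j⟩
      fin_cases b <;> simp [Q]
    rw [this, Matrix.det_permute']
    ring

theorem det_stdSkew (m : ℕ) : (stdSkew m).det = 1 := by
  simp [stdSkew, Matrix.det_blockDiagonal, Matrix.det_fin_two]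

theorem stdSkew_apply {m : ℕ} (x y : Fin 2 × Fin m) : stdSkew m x y =
    if x.2 = y.2 then (if x.1 = y.1 then 0 else if x.1 = 0 then 1 else -1) else 0 := by
  obtain ⟨b, j⟩ := x
  obtain ⟨b', j'⟩ := y
  simp only [stdSkew, Matrix.blockDiagonal_apply]
  fin_cases b <;> fin_cases b' <;> simp

/-- If the term is nonzero, `σ` maps pairs onto pairs. It is then a permutation `π` of the pairs,
which acts on both halves and so is even, composed with swaps inside pairs; each swap contributes
`-1` both to the sign and to the product. -/
theorem rawPf_stdSkew_term_nonneg {m : ℕ} (σ : Equiv.Perm (Fin 2 × Fin m)) :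
    0 ≤ ((Equiv.Perm.sign σ : ℤ) : ℚ) * ∏ j, stdSkew m (σ (0, j)) (σ (1, j)) := by
  by_cases h0 : ∏ j, stdSkew m (σ (0, j)) (σ (1, j)) = 0
  · simp [h0]
  rw [← ne_eq, Finset.prod_ne_zero_iff] at h0
  have hj : ∀ j, (σ (1, j)).2 = (σ (0, j)).2 ∧ (σ (1, j)).1 ≠ (σ (0, j)).1 := by
    intro j
    have := h0 j (mem_univ j)
    rw [stdSkew_apply] at this
    by_cases h1 : (σ (0, j)).2 = (σ (1, j)).2
    · by_cases h2 : (σ (0, j)).1 = (σ (1, j)).1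
      · simp [h1, h2] at this
      · exact ⟨h1.symm, fun h => h2 h.symm⟩
    · simp [h1] at this
  have hinj : Function.Injective (fun j => (σ (0, j)).2) := by
    intro i j hij
    simp only at hij
    by_cases hb : (σ (0, i)).1 = (σ (0, j)).1
    · have := σ.injective (Prod.ext hb hij)
      simpa using this
    · have h1 : (σ (0, i)).1 = (σ (1, j)).1 := by
        have := (hj j).2
        omega
      have := σ.injective (Prod.ext h1 (hij.trans (hj j).1.symm))
      simp at this
  let π : Equiv.Perm (Fin m) := Equiv.ofBijective _ (Finite.injective_iff_bijective.mp hinj)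
  let d : Fin m → Equiv.Perm (Fin 2) := fun j => if (σ (0, j)).1 = 0 then 1 else Equiv.swap 0 1
  have hσ : σ = (Equiv.prodCongrRight fun _ : Fin 2 => π) * (Equiv.prodCongrLeft d) := by
    ext1 ⟨b, j⟩
    have := hj j
    have h2 : ∀ x : Fin 2, x = 0 ∨ x = 1 := by decide
    simp only [Equiv.Perm.mul_apply, Equiv.prodCongrLeft_apply, Equiv.prodCongrRight_apply, π, d,
      Equiv.ofBijective_apply]
    refine Prod.ext ?_ ?_
    · rcases h2 b with rfl | rfl <;> rcases h2 (σ (0, j)).1 with h | h <;>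
        rcases h2 (σ (1, j)).1 with h' | h' <;> simp_all
    · rcases h2 b with rfl | rfl
      · rfl
      · exact this.1
  have hs : ((Equiv.Perm.sign σ : ℤ) : ℚ) = ∏ j, (if (σ (0, j)).1 = 0 then (1 : ℚ) else -1) := by
    conv_lhs => rw [hσ]
    rw [map_mul]
    simp only [Equiv.Perm.sign_prodCongrRight, Equiv.Perm.sign_prodCongrLeft, Fin.prod_univ_two,
      Int.units_mul_self, one_mul]
    push_cast
    refine Finset.prod_congr rfl fun j _ => ?_
    simp only [d]
    split_ifs <;> simp
  rw [hs, ← Finset.prod_mul_distrib]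
  refine Finset.prod_nonneg fun j _ => ?_
  rw [stdSkew_apply, if_pos (hj j).1.symm, if_neg (hj j).2.symm]
  split_ifs <;> norm_num

/-- This number is the overcount of `rawPf` relative to the Pfaffian; only its positivity is needed,
to cancel it. -/
theorem rawPf_stdSkew_pos (m : ℕ) : 0 < rawPf (stdSkew m) := by
  refine Finset.sum_pos' (fun σ _ => rawPf_stdSkew_term_nonneg σ) ⟨1, mem_univ _, ?_⟩
  simp [stdSkew_apply]

/-- Skew Gaussian elimination: a nonzero entry at `(q, p)` allows subtracting a form of rank two so
that rows `p` and `q` of the remainder vanish. The supporting set `s` then loses two elements and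
drives the induction. -/
theorem exists_skew_decomposition {ι : Type*} [DecidableEq ι] (m : ℕ) :
    ∀ (X : ι → ι → ℚ) (s : Finset ι), (∀ i j, X j i = - X i j) →
      (∀ i j, i ∉ s → X i j = 0) → s.card ≤ 2 * m →
      ∃ u v : Fin m → ι → ℚ, ∀ i j, X i j = ∑ k, (u k i * v k j - v k i * u k j) := by
  induction m with
  | zero =>
    intro X s _ hs hc
    have : s = ∅ := by simpa using hc
    subst this
    exact ⟨fun _ _ => 0, fun _ _ => 0, fun i j => by simp [hs i j]⟩
  | succ m ih =>
    intro X s hskew hs hc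
    by_cases hX : ∀ i j, X i j = 0
    · exact ⟨fun _ _ => 0, fun _ _ => 0, fun i j => by simp [hX]⟩
    push Not at hX
    obtain ⟨q, p, hqp⟩ := hX
    have hdiag : ∀ i, X i i = 0 := fun i => by linarith [hskew i i]
    have hne : p ≠ q := by
      rintro rfl
      exact hqp (hdiag p)
    have hps : p ∈ s := by
      by_contra h
      exact hqp (by rw [hskew, hs p q h, neg_zero])
    have hqs : q ∈ s := by
      by_contra h
      exact hqp (hs q p h)
    obtain ⟨u, v, huv⟩ := ih
      (fun i j => X i j - (X i q / X q p * X j p - X i p * (X j q / X q p)))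
      ((s.erase p).erase q) (fun i j => by simp only [hskew i j]; ring) (fun i j hi => by
        by_cases h1 : i = p
        · subst h1
          rw [hdiag i, hskew q i, hskew i j]
          field_simp
          ring
        by_cases h2 : i = q
        · subst h2
          rw [hdiag i, hskew i j]
          field_simp
          ring
        have : i ∉ s := fun h => hi (by simp [h1, h2, h])
        rw [hs i j this, hs i q this, hs i p this]
        ring) (by
        rw [Finset.card_erase_of_mem (by simp [hqs, hne.symm]), Finset.card_erase_of_mem hps]
        omega)
    refine ⟨Fin.cons (fun i => X i q / X q p) u, Fin.cons (fun i => X i p) v, fun i j => ?_⟩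
    rw [Fin.sum_univ_succ]
    simp only [Fin.cons_zero, Fin.cons_succ, ← huv]
    ring

/-- A skew matrix is `A * stdSkew m * Aᵀ` for some, possibly singular, `A`; then both sides equal
`A.det ^ 2` times the square of the constant. -/
theorem rawPf_sq {m : ℕ} (X : Matrix (Fin 2 × Fin m) (Fin 2 × Fin m) ℚ)
    (hX : ∀ i j, X j i = - X i j) : rawPf X ^ 2 = rawPf (stdSkew m) ^ 2 * X.det := by
  obtain ⟨u, v, huv⟩ := exists_skew_decomposition m X univ hX (fun i j h => by simp at h)
    (by simp)
  let A : Matrix (Fin 2 × Fin m) (Fin 2 × Fin m) ℚ :=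
    Matrix.of fun i y => if y.1 = 0 then u y.2 i else v y.2 i
  have hA : X = A * stdSkew m * Aᵀ := by
    ext i j
    rw [huv, Matrix.mul_apply, Fintype.sum_prod_type_right]
    refine Finset.sum_congr rfl fun k _ => ?_
    simp only [Fin.sum_univ_two, Matrix.mul_apply, Fintype.sum_prod_type_right, stdSkew_apply,
      Matrix.transpose_apply, A, Matrix.of_apply]
    simp
    ring
  rw [hA, rawPf_congr, Matrix.det_mul, Matrix.det_mul, Matrix.det_transpose, det_stdSkew]
  ring

end BoxPP

/-! ### Determinants and Pfaffians of signed graphs as sums over matchings. -/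

namespace BoxPP

open Finset Matrix

/-- A finite directed multigraph with edge weights `±1` whose edges can be reversed, reversal
changing the sign of the weight. -/
structure SkewNet (V E : Type*) where
  src : E → V
  tgt : E → V
  rev : E → E
  w : E → ℚ
  src_rev : ∀ e, src (rev e) = tgt e
  tgt_rev : ∀ e, tgt (rev e) = src e
  rev_rev : ∀ e, rev (rev e) = e
  w_rev : ∀ e, w (rev e) = - w e
  w_sq : ∀ e, w e * w e = 1

namespace SkewNet

set_option linter.unusedSectionVars false

variable {V E : Type*} [Fintype V] [DecidableEq V] [Fintype E] [DecidableEq E] (N : SkewNet V E)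

/-- The weighted adjacency matrix. -/
def adj : Matrix V V ℚ :=
  Matrix.of fun x y => ∑ e, if N.src e = x ∧ N.tgt e = y then N.w e else 0

/-- The choices of an outgoing edge at each vertex. -/
def sections : Finset (V → E) := Fintype.piFinset fun x => univ.filter fun e => N.src e = x

/-- The weighted adjacency matrix of the chosen edges. -/
def secMat (f : V → E) : Matrix V V ℚ :=
  Matrix.of fun x y => if y = N.tgt (f x) then N.w (f x) else 0

open Classical in
/-- The choices of outgoing edges that form a permutation of the vertices. -/
noncomputable def matchings : Finset (V → E) :=
  N.sections.filter fun f => Function.Injective fun x => N.tgt (f x)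

/-- The choices of outgoing edges that form a perfect matching of the underlying undirected
graph. -/
def symMatchings : Finset (V → E) :=
  N.sections.filter fun f => ∀ x, f (N.tgt (f x)) = N.rev (f x)

variable {N} in
theorem mem_sections {f : V → E} : f ∈ N.sections ↔ ∀ x, N.src (f x) = x := by
  simp [sections, Fintype.mem_piFinset]

variable {N} in
theorem mem_matchings {f : V → E} : f ∈ N.matchings ↔
    (∀ x, N.src (f x) = x) ∧ Function.Injective fun x => N.tgt (f x) := by
  simp [matchings, mem_sections]

variable {N} in
theorem mem_symMatchings {f : V → E} : f ∈ N.symMatchings ↔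
    (∀ x, N.src (f x) = x) ∧ ∀ x, f (N.tgt (f x)) = N.rev (f x) := by
  simp [symMatchings, mem_sections]

theorem w_ne_zero (e : E) : N.w e ≠ 0 := fun h => by
  have := N.w_sq e
  simp [h] at this

theorem det_secMat_eq_zero {f : V → E} (hf : ¬ Function.Injective fun x => N.tgt (f x)) :
    (N.secMat f).det = 0 := by
  simp only [Function.Injective, not_forall] at hf
  obtain ⟨x, y, hxy, hne⟩ := hf
  have hmul : (N.secMat f) x = (N.w (f x) * N.w (f y)) • (N.secMat f) y := by
    funext z
    simp only [secMat, Matrix.of_apply, Pi.smul_apply, smul_eq_mul, hxy]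
    split_ifs
    · rw [mul_assoc, N.w_sq, mul_one]
    · simp
  have h := Matrix.det_updateRow_smul (N.secMat f) x (N.w (f x) * N.w (f y)) ((N.secMat f) y)
  rw [← hmul, Matrix.updateRow_eq_self] at h
  rw [h, Matrix.det_zero_of_row_eq hne, mul_zero]
  rw [Matrix.updateRow_self, Matrix.updateRow_ne (Ne.symm hne)]

/-- The expansion is multilinear in the rows, each row being a sum over outgoing edges. Parallel
edges, which occur in quotient graphs, thus stay separate. Choices with a repeated target have
proportional rows. -/
theorem det_adj : N.adj.det = ∑ f ∈ N.matchings, (N.secMat f).det := by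
  have h1 : N.adj = Matrix.of fun x => ∑ e ∈ univ.filter (fun e => N.src e = x),
      fun y => if y = N.tgt e then N.w e else 0 := by
    ext x y
    simp only [adj, Matrix.of_apply, Finset.sum_apply, Finset.sum_filter]
    refine Finset.sum_congr rfl fun e _ => ?_
    by_cases h : N.src e = x <;> simp [h, eq_comm]
  have h2 : N.adj.det = ∑ f ∈ N.sections, (N.secMat f).det := by
    rw [h1]
    exact MultilinearMap.map_sum_finset (Matrix.detRowAlternating (n := V) (R := ℚ)).toMultilinearMap
      (fun _ e => fun y => if y = N.tgt e then N.w e else 0)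
      (fun x => univ.filter fun e => N.src e = x)
  rw [h2, matchings, Finset.sum_filter_of_ne]
  intro f _ hf
  by_contra h
  exact hf (N.det_secMat_eq_zero h)

theorem adj_skew (x y : V) : N.adj y x = - N.adj x y := by
  simp only [adj, Matrix.of_apply, ← Finset.sum_neg_distrib]
  let r : Equiv.Perm E := ⟨N.rev, N.rev, N.rev_rev, N.rev_rev⟩
  rw [← Equiv.sum_comp r]
  refine Finset.sum_congr rfl fun e _ => ?_
  simp only [r, Equiv.coe_fn_mk, N.src_rev, N.tgt_rev, N.w_rev]
  by_cases h : N.src e = x ∧ N.tgt e = y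
  · rw [if_pos h.symm, if_pos h]
  · rw [if_neg (fun h' => h h'.symm), if_neg h, neg_zero]

variable {N} in
theorem tgt_tgt {f : V → E} (hf : f ∈ N.symMatchings) (x : V) : N.tgt (f (N.tgt (f x))) = x := by
  rw [mem_symMatchings] at hf
  rw [hf.2, N.tgt_rev, hf.1]

variable {N} in
theorem secMat_skew {f : V → E} (hf : f ∈ N.symMatchings) (x y : V) :
    N.secMat f y x = - N.secMat f x y := by
  have h := tgt_tgt hf
  rw [mem_symMatchings] at hf
  simp only [secMat, Matrix.of_apply]
  by_cases h1 : y = N.tgt (f x)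
  · subst h1
    rw [if_pos (h x).symm, if_pos rfl, hf.2, N.w_rev]
  · rw [if_neg h1, if_neg, neg_zero]
    rintro rfl
    exact h1 (h y).symm

-- For a matching this is a signed permutation matrix, hence orthogonal.
variable {N} in
theorem det_secMat_mul_self {f : V → E} (hf : f ∈ N.matchings) :
    (N.secMat f).det * (N.secMat f).det = 1 := by
  have h : N.secMat f * (N.secMat f)ᵀ = 1 := by
    have h := (mem_matchings.mp hf).2
    ext x y
    rw [Matrix.mul_apply, Matrix.one_apply, Finset.sum_eq_single (N.tgt (f x))]
    · simp only [secMat, Matrix.of_apply, Matrix.transpose_apply, if_true]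
      by_cases hxy : x = y
      · subst hxy
        simp [N.w_sq]
      · rw [if_neg hxy, if_neg, mul_zero]
        exact fun h2 => hxy (h h2)
    · intro z _ hz
      simp [secMat, hz]
    · simp
  have h2 := congrArg Matrix.det h
  rwa [Matrix.det_mul, Matrix.det_transpose, Matrix.det_one] at h2

theorem symMatchings_subset : N.symMatchings ⊆ N.matchings := by
  intro f hf
  refine mem_matchings.mpr ⟨(mem_symMatchings.mp hf).1, fun x y hxy => ?_⟩
  rw [← tgt_tgt hf x, ← tgt_tgt hf y]
  exact congrArg (fun z => N.tgt (f z)) hxy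

theorem det_eq_zero_of_skew_of_odd (M : Matrix V V ℚ) (hM : ∀ x y, M y x = - M x y)
    (hodd : Odd (Fintype.card V)) : M.det = 0 := by
  have h : Mᵀ = -M := by
    ext x y
    simp [hM x y]
  have h2 := Matrix.det_transpose M
  rw [h, Matrix.det_neg, hodd.neg_one_pow] at h2
  linarith

/-- For a fixed arrangement `σ` into pairs, both sides sum over choices of an edge inside each pair:
such a choice extends uniquely to a symmetric matching, by the reversed edge at the second vertex of
each pair. -/
theorem rawPf_adj {m : ℕ} (e : Fin 2 × Fin m ≃ V) :
    rawPf (N.adj.submatrix e e) =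
      ∑ f ∈ N.symMatchings, rawPf ((N.secMat f).submatrix e e) := by
  simp only [rawPf]
  rw [Finset.sum_comm]
  refine Finset.sum_congr rfl fun σ _ => ?_
  rw [← Finset.mul_sum]
  congr 1
  simp only [Matrix.submatrix_apply, adj, Matrix.of_apply]
  rw [Finset.prod_univ_sum, Fintype.piFinset_univ]
  symm
  have key : ∀ f ∈ N.symMatchings,
      ∏ j, N.secMat f (e (σ (0, j))) (e (σ (1, j))) ≠ 0 →
      ∀ j, e (σ (1, j)) = N.tgt (f (e (σ (0, j)))) := by
    intro f _ h j
    rw [Finset.prod_ne_zero_iff] at h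
    have := h j (mem_univ j)
    simp only [secMat, Matrix.of_apply, ne_eq, ite_eq_right_iff, not_forall] at this
    exact this.1
  refine Finset.sum_bij_ne_zero (fun f _ _ j => f (e (σ (0, j)))) (by simp) ?_ ?_ ?_
  · intro f hf h0 f' hf' h0' hff
    have k := key f hf h0
    have k' := key f' hf' h0'
    rw [mem_symMatchings] at hf hf'
    funext x
    obtain ⟨⟨b, j⟩, rfl⟩ : ∃ y, x = e (σ y) := ⟨σ.symm (e.symm x), by simp⟩
    have h1 := congrFun hff j
    fin_cases b
    · exact h1
    · change f (e (σ (1, j))) = f' (e (σ (1, j)))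
      rw [k j, hf.2, h1, ← hf'.2, ← h1, ← k j, k' j]
  · intro κ _ hκ
    rw [Finset.prod_ne_zero_iff] at hκ
    have hκ' : ∀ j, N.src (κ j) = e (σ (0, j)) ∧ N.tgt (κ j) = e (σ (1, j)) := by
      intro j
      have := hκ j (mem_univ j)
      simp only [ne_eq, ite_eq_right_iff, not_forall] at this
      exact this.1
    let τ : Fin 2 × Fin m ≃ V := σ.trans e
    let f : V → E := fun x =>
      if (τ.symm x).1 = 0 then κ (τ.symm x).2 else N.rev (κ (τ.symm x).2)
    have f0 : ∀ j, f (e (σ (0, j))) = κ j := by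
      intro j
      simp [f, τ]
    have f1 : ∀ j, f (e (σ (1, j))) = N.rev (κ j) := by
      intro j
      simp [f, τ]
    have hf : f ∈ N.symMatchings := by
      rw [mem_symMatchings]
      constructor <;> intro x <;>
        obtain ⟨⟨b, j⟩, rfl⟩ : ∃ y, x = e (σ y) := ⟨σ.symm (e.symm x), by simp⟩ <;> fin_cases b
      · change N.src (f (e (σ (0, j)))) = e (σ (0, j))
        rw [f0, (hκ' j).1]
      · change N.src (f (e (σ (1, j)))) = e (σ (1, j))
        rw [f1, N.src_rev, (hκ' j).2]
      · change f (N.tgt (f (e (σ (0, j))))) = N.rev (f (e (σ (0, j))))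
        rw [f0, (hκ' j).2, f1]
      · change f (N.tgt (f (e (σ (1, j))))) = N.rev (f (e (σ (1, j))))
        rw [f1, N.tgt_rev, (hκ' j).1, f0, N.rev_rev]
    refine ⟨f, hf, ?_, funext f0⟩
    rw [Finset.prod_ne_zero_iff]
    intro j _
    simp [secMat, f0, (hκ' j).2, N.w_ne_zero]
  · intro f hf h0
    have k := key f hf h0
    rw [mem_symMatchings] at hf
    refine Finset.prod_congr rfl fun j _ => ?_
    simp [secMat, hf.1, eq_comm]

/-- If all perfect matchings contribute with the same sign to the Pfaffian, then the determinant of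
the adjacency matrix is the square of their number. -/
theorem det_adj_eq_sq (h : ∀ f ∈ N.symMatchings, ∀ f' ∈ N.symMatchings,
    ∃ c : Matrix V V ℚ, c.det = 1 ∧ c * N.secMat f * cᵀ = N.secMat f') :
    N.adj.det = (N.symMatchings.card : ℚ) ^ 2 := by
  rcases Nat.even_or_odd (Fintype.card V) with ⟨m, hm⟩ | hodd
  · have e : Fin 2 × Fin m ≃ V := Fintype.equivOfCardEq (by simp [hm, two_mul])
    set C := rawPf (stdSkew m)
    have hC : 0 < C := rawPf_stdSkew_pos m
    have hsq : ∀ f ∈ N.symMatchings, rawPf ((N.secMat f).submatrix e e) ^ 2 = C ^ 2 := by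
      intro f hf
      have h1 := rawPf_sq ((N.secMat f).submatrix e e) (fun i j => secMat_skew hf _ _)
      rw [Matrix.det_submatrix_equiv_self] at h1
      have h2 := det_secMat_mul_self (N.symMatchings_subset hf)
      -- The determinant squares to one, and a positive multiple of it is a square, which excludes
      -- `-1`.
      have h3 : 0 ≤ (N.secMat f).det := by
        have := sq_nonneg (rawPf ((N.secMat f).submatrix e e))
        rw [h1] at this
        exact nonneg_of_mul_nonneg_right this (by positivity)
      have h4 : (N.secMat f).det = 1 := by nlinarith
      rw [h1, h4, mul_one]
    have hconst : ∀ f ∈ N.symMatchings, ∀ f' ∈ N.symMatchings,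
        rawPf ((N.secMat f').submatrix e e) = rawPf ((N.secMat f).submatrix e e) := by
      intro f hf f' hf'
      obtain ⟨c, hc, hcc⟩ := h f hf f' hf'
      have : (N.secMat f').submatrix e e =
          c.submatrix e e * (N.secMat f).submatrix e e * (c.submatrix e e)ᵀ := by
        rw [Matrix.transpose_submatrix, Matrix.submatrix_mul_equiv, Matrix.submatrix_mul_equiv, hcc]
      rw [this, rawPf_congr, Matrix.det_submatrix_equiv_self, hc, one_mul]
    have hA := rawPf_sq (N.adj.submatrix e e) (fun i j => N.adj_skew _ _)
    rw [Matrix.det_submatrix_equiv_self] at hA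
    have hS : rawPf (N.adj.submatrix e e) ^ 2 = C ^ 2 * (N.symMatchings.card : ℚ) ^ 2 := by
      rw [rawPf_adj]
      rcases N.symMatchings.eq_empty_or_nonempty with h0 | ⟨f, hf⟩
      · simp [h0]
      · rw [Finset.sum_congr rfl fun f' hf' => hconst f hf f' hf', Finset.sum_const, nsmul_eq_mul,
          mul_pow, hsq f hf, mul_comm]
    exact mul_left_cancel₀ (pow_ne_zero 2 hC.ne') (hA.symm.trans hS)
  · rw [det_eq_zero_of_skew_of_odd _ N.adj_skew hodd]
    -- A symmetric matching would give a skew matrix of odd size with determinant of square one.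
    have : N.symMatchings = ∅ := by
      by_contra hne
      obtain ⟨f, hf⟩ := Finset.nonempty_iff_ne_empty.mpr hne
      have := det_secMat_mul_self (N.symMatchings_subset hf)
      rw [det_eq_zero_of_skew_of_odd _ (secMat_skew hf) hodd] at this
      simp at this
    simp [this]

/-- The permutation matrix of `π` with row `π x` multiplied by `η x`. -/
def signedPerm (π : Equiv.Perm V) (η : V → ℚ) : Matrix V V ℚ :=
  Matrix.of fun x y => if x = π y then η y else 0

theorem det_signedPerm (π : Equiv.Perm V) (η : V → ℚ) :
    (signedPerm π η).det = (Equiv.Perm.sign π : ℤ) * ∏ x, η x := by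
  rw [Matrix.det_apply', Finset.sum_eq_single π]
  · simp [signedPerm]
  · intro σ _ hσ
    obtain ⟨x, hx⟩ : ∃ x, σ x ≠ π x := by
      by_contra hc
      push Not at hc
      exact hσ (Equiv.ext hc)
    rw [Finset.prod_eq_zero (mem_univ x), mul_zero]
    simp [signedPerm, hx]
  · simp

theorem signedPerm_mul_apply (π : Equiv.Perm V) (η : V → ℚ) (M : Matrix V V ℚ) (x y : V) :
    (signedPerm π η * M) (π x) y = η x * M x y := by
  rw [Matrix.mul_apply, Finset.sum_eq_single x]
  · simp [signedPerm]
  · intro z _ hz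
    simp [signedPerm, hz.symm]
  · simp

/-- The two matrices differ by a signed permutation of the rows. As `π` is even, only the edge
weights contribute. -/
theorem det_secMat_of_comp {f f' : V → E} (π : Equiv.Perm V) (hπ : Equiv.Perm.sign π = 1)
    (h : ∀ x, N.tgt (f' (π x)) = N.tgt (f x)) :
    (N.secMat f').det = (∏ x, N.w (f x) * N.w (f' x)) * (N.secMat f).det := by
  have key : N.secMat f' = signedPerm π (fun x => N.w (f x) * N.w (f' (π x))) * N.secMat f := by
    ext x y
    obtain ⟨z, rfl⟩ := π.surjective x
    rw [signedPerm_mul_apply]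
    simp only [secMat, Matrix.of_apply, h]
    split_ifs
    · linear_combination (- N.w (f' (π z))) * N.w_sq (f z)
    · simp
  rw [key, Matrix.det_mul, det_signedPerm, hπ, Finset.prod_mul_distrib, Finset.prod_mul_distrib,
    Equiv.prod_comp π (fun x => N.w (f' x))]
  simp

/-- Rows and columns are relabelled simultaneously by `π` and regauged by `η`; the product condition
on `η` makes the congruence have determinant one. -/
theorem exists_congr_of_conj {f f' : V → E} (π : Equiv.Perm V) (hπ : Equiv.Perm.sign π = 1)
    (h : ∀ x, N.tgt (f' (π x)) = π (N.tgt (f x))) (η : V → ℚ) (hη : ∏ x, η x = 1)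
    (hw : ∀ x, N.w (f' (π x)) = η x * η (N.tgt (f x)) * N.w (f x)) :
    ∃ c : Matrix V V ℚ, c.det = 1 ∧ c * N.secMat f * cᵀ = N.secMat f' := by
  refine ⟨signedPerm π η, by simp [det_signedPerm, hπ, hη], ?_⟩
  ext x y
  obtain ⟨x, rfl⟩ := π.surjective x
  obtain ⟨y, rfl⟩ := π.surjective y
  have : signedPerm π η * N.secMat f * (signedPerm π η)ᵀ =
      (signedPerm π η * (signedPerm π η * N.secMat f)ᵀ)ᵀ := by
    rw [Matrix.transpose_mul, Matrix.transpose_transpose]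
  rw [this, Matrix.transpose_apply, signedPerm_mul_apply, Matrix.transpose_apply,
    signedPerm_mul_apply]
  simp only [secMat, Matrix.of_apply, h, π.injective.eq_iff, hw]
  split_ifs with hy
  · rw [← hy]
    ring
  · simp

end SkewNet

theorem exists_three_cycle {V : Type*} [DecidableEq V] [Fintype V] (d : Fin 3 → V)
    (hd : Function.Injective d) : ∃ π : Equiv.Perm V, Equiv.Perm.sign π = 1 ∧
      (∀ j, π (d j) = d (j + 1)) ∧ ∀ x, (∀ j, x ≠ d j) → π x = x := by
  have h01 : d 0 ≠ d 1 := fun h => by simpa using hd h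
  have h12 : d 1 ≠ d 2 := fun h => by simpa using hd h
  have h02 : d 0 ≠ d 2 := fun h => by simpa using hd h
  refine ⟨Equiv.swap (d 0) (d 1) * Equiv.swap (d 1) (d 2), ?_, ?_, ?_⟩
  · simp [Equiv.Perm.sign_swap h01, Equiv.Perm.sign_swap h12]
  · intro j
    fin_cases j
    · simp [Equiv.swap_apply_of_ne_of_ne h01 h02]
    · simp [Equiv.swap_apply_of_ne_of_ne h02.symm h12.symm]
    · simp
  · intro x hx
    simp [Equiv.swap_apply_of_ne_of_ne (hx 0) (hx 1), Equiv.swap_apply_of_ne_of_ne (hx 1) (hx 2)]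

end BoxPP

/-! ### The triangular lattice, edge signs and height functions. -/

namespace BoxPP

open Finset

/-- Integer triples: cubes, and points and triangles of the triangular lattice. -/
abbrev Pt := Fin 3 → ℤ

theorem fin3_cases (k : Fin 3) : k = 0 ∨ k = 1 ∨ k = 2 := by
  revert k
  decide

/-- The `k`-th unit vector. -/
def unitVec (k : Fin 3) : Pt := Pi.single k 1

theorem unitVec_apply (k i : Fin 3) : unitVec k i = if i = k then 1 else 0 := by
  simp [unitVec, Pi.single_apply]

/-- The sum of the coordinates. -/
def total (p : Pt) : ℤ := p 0 + p 1 + p 2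

/-- The projection along the main diagonal onto the triangular lattice. -/
def proj (p : Pt) : Pt := fun i => p (i + 1) - p (i + 2)

/-- Cyclic shift of the coordinates. -/
def rot (g : Fin 3) (t : Pt) : Pt := fun i => t (i + g)

/-- The reflection in the centre of the triangle adjacent to `t` in direction `k`. -/
def nbr (k : Fin 3) (t : Pt) : Pt := unitVec k - 1 - t

/-- The sign of `x + 1/2`. -/
def sg (x : ℤ) : ℤ := if 0 ≤ x then 1 else -1

/-- The weight of the edge in direction `k` at the triangle `t`. -/
def wt (k : Fin 3) (t : Pt) : ℤ :=
  if t k = 0 then sg (t (k + 1)) else sg (t 0) * sg (t 1) * sg (t 2)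

theorem pt_ext {p q : Pt} (h0 : p 0 = q 0) (h1 : p 1 = q 1) (h2 : p 2 = q 2) : p = q := by
  funext i
  obtain rfl | rfl | rfl := fin3_cases i <;> assumption

theorem total_add (p q : Pt) : total (p + q) = total p + total q := by
  simp [total]; ring

theorem total_sub (p q : Pt) : total (p - q) = total p - total q := by
  simp [total]; ring

theorem total_neg (p : Pt) : total (-p) = - total p := by
  simp [total]; ring

theorem total_unitVec (k : Fin 3) : total (unitVec k) = 1 := by
  obtain rfl | rfl | rfl := fin3_cases k <;> simp [total, unitVec]

theorem total_one : total 1 = 3 := by simp [total]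

theorem total_rot (g : Fin 3) (p : Pt) : total (rot g p) = total p := by
  obtain rfl | rfl | rfl := fin3_cases g <;> simp [total, rot] <;> ring

theorem total_proj (p : Pt) : total (proj p) = 0 := by simp [total, proj]

theorem total_nbr {k : Fin 3} {t : Pt} (ht : total t = -1) : total (nbr k t) = -1 := by
  rw [nbr, total_sub, total_sub, total_unitVec, total_one, ht]; rfl

theorem nbr_nbr (k : Fin 3) (t : Pt) : nbr k (nbr k t) = t := by
  simp [nbr]

theorem rot_zero (p : Pt) : rot 0 p = p := by
  funext i; simp [rot]

theorem rot_rot (g g' : Fin 3) (p : Pt) : rot g (rot g' p) = rot (g + g') p := by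
  funext i; simp [rot, add_assoc]

theorem rot_add (g : Fin 3) (p q : Pt) : rot g (p + q) = rot g p + rot g q := rfl

theorem rot_sub (g : Fin 3) (p q : Pt) : rot g (p - q) = rot g p - rot g q := rfl

theorem rot_neg (g : Fin 3) (p : Pt) : rot g (-p) = - rot g p := rfl

theorem rot_one (g : Fin 3) : rot g 1 = 1 := rfl

theorem rot_unitVec (g k : Fin 3) : rot g (unitVec k) = unitVec (k - g) := by
  funext i
  simp [rot, unitVec_apply, eq_sub_iff_add_eq]

theorem rot_injective (g : Fin 3) : Function.Injective (rot g) := by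
  intro p q h
  have := congrArg (rot (-g)) h
  simpa [rot_rot, rot_zero] using this

theorem rot_nbr (g k : Fin 3) (t : Pt) : rot g (nbr k t) = nbr (k - g) (rot g t) := by
  simp [nbr, rot_sub, rot_unitVec, rot_one]

theorem rot_proj (g : Fin 3) (p : Pt) : rot g (proj p) = proj (rot g p) := by
  funext i
  simp [rot, proj, add_right_comm]

theorem proj_neg (p : Pt) : proj (-p) = - proj p := by
  funext i; simp [proj]; ring

theorem proj_add (p q : Pt) : proj (p + q) = proj p + proj q := by
  funext i; simp [proj]; ring

theorem proj_sub (p q : Pt) : proj (p - q) = proj p - proj q := by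
  funext i; simp [proj]; ring

theorem proj_one : proj 1 = 0 := by
  funext i; simp [proj]

theorem proj_unitVec (k : Fin 3) : proj (unitVec k) = unitVec (k + 2) - unitVec (k + 1) := by
  obtain rfl | rfl | rfl := fin3_cases k <;> refine pt_ext ?_ ?_ ?_ <;> simp [proj, unitVec]

theorem proj_eq_proj {p q : Pt} (h : proj p = proj q) : ∃ m : ℤ, q = p + fun _ => m := by
  have h0 := congrFun h 0
  have h1 := congrFun h 1
  have h2 := congrFun h 2
  simp [proj] at h0 h1 h2
  refine ⟨q 0 - p 0, pt_ext ?_ ?_ ?_⟩ <;> simp <;> omega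

theorem exists_proj_eq {v : Pt} (hv : total v = 0) : ∃ p, proj p = v := by
  refine ⟨![0, - v 2, v 1], pt_ext ?_ ?_ ?_⟩ <;> simp [proj]
  simp [total] at hv
  omega

theorem unitVec_add_add (k : Fin 3) : unitVec k + unitVec (k + 1) + unitVec (k + 2) = 1 := by
  obtain rfl | rfl | rfl := fin3_cases k <;> refine pt_ext ?_ ?_ ?_ <;> simp [unitVec]

/-- A fixed point of a nontrivial rotation has three equal coordinates, and `-1` is not divisible by
three. So rotations act freely on triangles, although they fix the central lattice point. -/
theorem rot_eq_self_of_total {g : Fin 3} {t : Pt} (ht : total t = -1) (h : rot g t = t) :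
    g = 0 := by
  have h0 := congrFun h 0
  have h1 := congrFun h 1
  have h2 := congrFun h 2
  simp only [total] at ht
  obtain rfl | rfl | rfl := fin3_cases g <;> simp [rot] at h0 h1 h2 ⊢ <;> omega

theorem sg_mul_self (x : ℤ) : sg x * sg x = 1 := by
  unfold sg; split_ifs <;> rfl

theorem wt_mul_self (k : Fin 3) (t : Pt) : wt k t * wt k t = 1 := by
  unfold wt
  split_ifs
  · exact sg_mul_self _
  · linear_combination (sg (t 1)^2 * sg (t 2)^2) * sg_mul_self (t 0) +
      (sg (t 2)^2) * sg_mul_self (t 1) + sg_mul_self (t 2)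

theorem wt_rot (g k : Fin 3) (t : Pt) : wt (k - g) (rot g t) = wt k t := by
  have h : sg (rot g t 0) * sg (rot g t 1) * sg (rot g t 2) = sg (t 0) * sg (t 1) * sg (t 2) := by
    obtain rfl | rfl | rfl := fin3_cases g <;> simp [rot] <;> ring
  have h1 : k - g + g = k := by abel
  have h2 : k - g + 1 + g = k + 1 := by abel
  rw [wt, wt, h]
  simp only [rot, h1, h2]

/-- Passing to `nbr k t` sends `x` to `-1 - x` in the two coordinates other than `k`, which flips
`sg`, and to `-x` in coordinate `k`, which flips `sg` unless `x = 0`. Hence the separate rule for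
edges on the axis `t k = 0`. -/
theorem wt_nbr {k : Fin 3} {t : Pt} (ht : total t = -1) : wt k (nbr k t) = - wt k t := by
  simp only [total] at ht
  obtain rfl | rfl | rfl := fin3_cases k <;> simp [wt, nbr, unitVec, sg] <;>
    split_ifs <;> omega

/-- Off the three axes, the two edges at each `v - unitVec i` carry the same sign and cancel; the
points on the axes are settled by cases. At the centre each of the three triangles contributes `-1`.
-/
theorem wt_flux {v : Pt} (hv : total v = 0) :
    ∏ i : Fin 3, (wt (i + 1) (v - unitVec i) * wt (i + 2) (v - unitVec i)) =
      if v = 0 then -1 else 1 := by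
  have hv0 : v = 0 ↔ v 0 = 0 ∧ v 1 = 0 ∧ v 2 = 0 :=
    ⟨fun h => by simp [h], fun h => pt_ext h.1 h.2.1 h.2.2⟩
  simp only [total] at hv
  have hneg : ∀ x : ℤ, x < 0 → x ≠ 0 ∧ sg x = -1 ∧ sg (x - 1) = -1 := fun x hx =>
    ⟨hx.ne, if_neg (by omega), if_neg (by omega)⟩
  have hpos : ∀ x : ℤ, 0 < x → x ≠ 0 ∧ sg x = 1 ∧ sg (x - 1) = 1 := fun x hx =>
    ⟨hx.ne', if_pos (by omega), if_pos (by omega)⟩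
  have hz : sg 0 = 1 ∧ sg (-1) = -1 := by decide
  rw [Fin.prod_univ_three]
  rcases lt_trichotomy (v 0) 0 with h0 | h0 | h0 <;> rcases lt_trichotomy (v 1) 0 with h1 | h1 | h1 <;>
    rcases lt_trichotomy (v 2) 0 with h2 | h2 | h2 <;> first | (exfalso; omega) | skip
  all_goals
    first | have e0 := hneg _ h0 | have e0 := hpos _ h0 | skip
    first | have e1 := hneg _ h1 | have e1 := hpos _ h1 | skip
    first | have e2 := hneg _ h2 | have e2 := hpos _ h2 | skip
    simp [wt, unitVec_apply, *]

/-- A height function on the triangular lattice. -/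
structure IsHeight (h : Pt → ℤ) : Prop where
  step : ∀ v, total v = 0 → ∀ k, h (v + unitVec (k + 2) - unitVec (k + 1)) ≤ h v + 1
  cong : ∀ v, total v = 0 → (3 : ℤ) ∣ h v + v 2 - v 1

/-- The direction in which the triangle `t` is matched: the side along which the height drops. -/
def dir (h : Pt → ℤ) (t : Pt) : Fin 3 :=
  if h (t + unitVec 2) < h (t + unitVec 1) then 0
  else if h (t + unitVec 0) < h (t + unitVec 2) then 1 else 2

namespace IsHeight

variable {h h' : Pt → ℤ}

theorem black (hh : IsHeight h) {t : Pt} (ht : total t = -1) (k : Fin 3) :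
    h (t + unitVec (k + 2)) ≤ h (t + unitVec (k + 1)) + 1 ∧
      (3 : ℤ) ∣ h (t + unitVec (k + 2)) - h (t + unitVec (k + 1)) - 1 := by
  have hs : ∀ j, total (t + unitVec j) = 0 := fun j => by
    rw [total_add, total_unitVec, ht]; rfl
  constructor
  · have := hh.step _ (hs (k + 1)) k
    rwa [show t + unitVec (k + 1) + unitVec (k + 2) - unitVec (k + 1) = t + unitVec (k + 2) by abel]
      at this
  · have h1 := hh.cong _ (hs (k + 1))
    have h2 := hh.cong _ (hs (k + 2))
    obtain rfl | rfl | rfl := fin3_cases k <;> simp [unitVec_apply] at h1 h2 ⊢ <;> omega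

theorem white (hh : IsHeight h) {s : Pt} (hs : total s = 1) (k : Fin 3) :
    h (s - unitVec (k + 1)) ≤ h (s - unitVec (k + 2)) + 1 ∧
      (3 : ℤ) ∣ h (s - unitVec (k + 1)) - h (s - unitVec (k + 2)) - 1 := by
  have hs' : ∀ j, total (s - unitVec j) = 0 := fun j => by
    rw [total_sub, total_unitVec, hs]; rfl
  constructor
  · have := hh.step _ (hs' (k + 2)) k
    rwa [show s - unitVec (k + 2) + unitVec (k + 2) - unitVec (k + 1) = s - unitVec (k + 1) by abel]
      at this
  · have h1 := hh.cong _ (hs' (k + 1))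
    have h2 := hh.cong _ (hs' (k + 2))
    obtain rfl | rfl | rfl := fin3_cases k <;> simp [unitVec_apply] at h1 h2 ⊢ <;> omega

/-- The three increments around a triangle sum to zero, are at most `1` and are `1` modulo `3`; so
exactly one is `-2` and the others are `1`. -/
theorem dir_iff (hh : IsHeight h) {t : Pt} (ht : total t = -1) {k : Fin 3} :
    dir h t = k ↔ h (t + unitVec (k + 2)) < h (t + unitVec (k + 1)) := by
  have h0 := hh.black ht 0
  have h1 := hh.black ht 1
  have h2 := hh.black ht 2
  simp at h0 h1 h2
  obtain rfl | rfl | rfl := fin3_cases k <;> simp [dir] <;> split_ifs <;> simp <;> omega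

theorem dir_lt (hh : IsHeight h) {t : Pt} (ht : total t = -1) :
    h (t + unitVec (dir h t + 2)) = h (t + unitVec (dir h t + 1)) - 2 := by
  have h0 := hh.black ht 0
  have h1 := hh.black ht 1
  have h2 := hh.black ht 2
  have h3 := (hh.dir_iff ht).mp rfl
  obtain hk | hk | hk := fin3_cases (dir h t) <;> simp [hk] at h0 h1 h2 h3 ⊢ <;> omega

/-- The increment of the height along the side of `t` in direction `k`. -/
theorem increment (hh : IsHeight h) {t : Pt} (ht : total t = -1) (k : Fin 3) :
    h (t + unitVec (k + 2)) - h (t + unitVec (k + 1)) = if dir h t = k then -2 else 1 := by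
  have h0 := hh.black ht 0
  have h1 := hh.black ht 1
  have h2 := hh.black ht 2
  have h3 := hh.dir_iff (k := k) ht
  split_ifs with hk
  · subst hk
    have := hh.dir_lt ht
    omega
  · rw [h3] at hk
    have := hh.black ht k
    omega

/-- The same count around the triangle `s` of the other orientation: the height drops along only one
of its sides, so `s` has only one partner. -/
theorem nbr_dir_injective (hh : IsHeight h) {t t' : Pt} (ht : total t = -1) (ht' : total t' = -1)
    (heq : nbr (dir h t) t = nbr (dir h t') t') : t = t' := by
  have h1 := (hh.dir_iff ht).mp rfl
  have h2 := (hh.dir_iff ht').mp rfl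
  generalize dir h t = k at *
  generalize dir h t' = k' at *
  set s : Pt := - nbr k t with hs
  have hst : total s = 1 := by rw [hs, total_neg, total_nbr ht]; rfl
  have e : ∀ (k : Fin 3) (t : Pt), s = - nbr k t →
      t + unitVec (k + 2) = s - unitVec (k + 1) ∧ t + unitVec (k + 1) = s - unitVec (k + 2) := by
    intro k t hs
    rw [hs, nbr, ← unitVec_add_add k]
    constructor <;> abel
  rw [(e k t hs).1, (e k t hs).2] at h1
  have hs' : s = - nbr k' t' := by rw [hs, heq]
  rw [(e k' t' hs').1, (e k' t' hs').2] at h2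
  have h3 := hh.white hst 0
  have h4 := hh.white hst 1
  have h5 := hh.white hst 2
  have hk : k = k' := by
    obtain rfl | rfl | rfl := fin3_cases k <;> obtain rfl | rfl | rfl := fin3_cases k' <;>
      simp at h1 h2 h3 h4 h5 ⊢ <;> omega
  subst hk
  simpa [nbr] using heq

/-- Raising one corner by `3` must turn an increment `-2` into `1` on one adjacent side and `1` into
`-2` on the other. -/
theorem dir_flip (hh : IsHeight h) (hh' : IsHeight h') {t : Pt} (ht : total t = -1) (j : Fin 3)
    (h0 : h' (t + unitVec j) = h (t + unitVec j) + 3)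
    (h1 : h' (t + unitVec (j + 1)) = h (t + unitVec (j + 1)))
    (h2 : h' (t + unitVec (j + 2)) = h (t + unitVec (j + 2))) :
    dir h t = j + 1 ∧ dir h' t = j + 2 := by
  rw [hh.dir_iff ht, hh'.dir_iff ht]
  have a0 := hh.black ht 0
  have a1 := hh.black ht 1
  have a2 := hh.black ht 2
  have b0 := hh'.black ht 0
  have b1 := hh'.black ht 1
  have b2 := hh'.black ht 2
  obtain rfl | rfl | rfl := fin3_cases j <;> simp at * <;> omega

theorem dir_congr {t : Pt} (H : ∀ j, h' (t + unitVec j) = h (t + unitVec j)) :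
    dir h' t = dir h t := by
  simp [dir, H]

theorem dir_rot (hh : IsHeight h) {g : Fin 3} (hg : ∀ v, h (rot g v) = h v) {t : Pt}
    (ht : total t = -1) : dir h (rot g t) = dir h t - g := by
  rw [hh.dir_iff (by rwa [total_rot])]
  have e : ∀ j, rot g t + unitVec j = rot g (t + unitVec (j + g)) := by
    intro j
    rw [rot_add, rot_unitVec, add_sub_cancel_right]
  rw [e, e, hg, hg]
  have h1 : dir h t - g + 2 + g = dir h t + 2 := by abel
  have h2 : dir h t - g + 1 + g = dir h t + 1 := by abel
  rw [h1, h2]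
  exact (hh.dir_iff ht).mp rfl

end IsHeight

end BoxPP

/-! ### Plane partitions as height functions on the hexagon. -/

namespace BoxPP

open Finset

/-- The half-widths of the hexagon of the box with half-dimensions `n`. -/
def hexL (n : Pt) : Pt := fun i => n (i + 1) + n (i + 2)

/-- The triangles of one of the two orientations in the hexagon. -/
noncomputable def hexagon (n : Pt) : Finset Pt :=
  (Finset.Icc (-hexL n) (hexL n - 1)).filter fun t => total t = -1

/-- The lattice points in the interior of the hexagon. -/
def Interior (n v : Pt) : Prop := ∀ i, -hexL n i < v i ∧ v i < hexL n i

/-- Plane partitions in the box centred at the origin with half-dimensions `n`. -/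
def IsPP (n : Pt) (P : Finset Pt) : Prop :=
  P ⊆ Finset.Icc (1 - n) n ∧ ∀ p ∈ P, ∀ q ∈ Finset.Icc (1 - n) n, q ≤ p → q ∈ P

/-- The order ideal of space generated by a plane partition and the walls of the box. -/
def ideal (n : Pt) (P : Finset Pt) : Set Pt :=
  {p | (∀ i, p i ≤ n i) ∧ (p ∈ P ∨ ∃ i, p i ≤ - n i)}

/-- The height function of a plane partition. -/
noncomputable def ht (n : Pt) (P : Finset Pt) (v : Pt) : ℤ :=
  sSup {s | ∃ p ∈ ideal n P, proj p = v ∧ total p = s}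

theorem mem_box {n p : Pt} : p ∈ Finset.Icc (1 - n) n ↔ ∀ i, 1 - n i ≤ p i ∧ p i ≤ n i := by
  simp [Pi.le_def, forall_and]

theorem mem_hexagon {n t : Pt} :
    t ∈ hexagon n ↔ total t = -1 ∧ ∀ i, -hexL n i ≤ t i ∧ t i < hexL n i := by
  simp only [hexagon, mem_filter, Finset.mem_Icc, Pi.le_def, Pi.neg_apply, Pi.sub_apply,
    Pi.one_apply, ← forall_and, and_comm, Int.le_sub_one_iff]

theorem nbr_mem_hexagon {n t : Pt} (ht : t ∈ hexagon n) {k : Fin 3} (hk : t k ≠ -hexL n k) :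
    nbr k t ∈ hexagon n := by
  rw [mem_hexagon] at ht ⊢
  refine ⟨total_nbr ht.1, fun i => ?_⟩
  have h1 := ht.2 i
  simp only [nbr, Pi.sub_apply, Pi.one_apply, unitVec_apply]
  split_ifs with h
  · subst h
    omega
  · omega

theorem nbr_valid {n t : Pt} (ht : t ∈ hexagon n) {k : Fin 3} : nbr k t k ≠ -hexL n k := by
  have := ((mem_hexagon.mp ht).2 k).2
  simp [nbr, unitVec_apply]
  omega

theorem isPP_empty (n : Pt) : IsPP n ∅ := by simp [IsPP]

section Ideal

variable {n : Pt} {P Q : Finset Pt}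

theorem IsPP.isLowerSet (hP : IsPP n P) : IsLowerSet (ideal n P) := by
  intro p q hqp hp
  refine ⟨fun i => (hqp i).trans (hp.1 i), ?_⟩
  by_cases h : ∃ i, q i ≤ - n i
  · exact Or.inr h
  push Not at h
  rcases hp.2 with hp2 | ⟨i, hi⟩
  · refine Or.inl (hP.2 p hp2 q (mem_box.mpr fun i => ?_) hqp)
    have h1 := h i
    have h2 : q i ≤ p i := hqp i
    have h3 := hp.1 i
    omega
  · have h1 := h i
    have h2 : q i ≤ p i := hqp i
    omega

theorem IsPP.mem_iff (hP : IsPP n P) {p : Pt} :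
    p ∈ P ↔ p ∈ Finset.Icc (1 - n) n ∧ p ∈ ideal n P := by
  constructor
  · intro h
    exact ⟨hP.1 h, fun i => (mem_box.mp (hP.1 h) i).2, Or.inl h⟩
  · rintro ⟨h1, _, h | ⟨i, hi⟩⟩
    · exact h
    · have := mem_box.mp h1 i
      omega

/-- Every diagonal line meets the ideal and leaves it eventually, so the supremum defining `ht` is
attained. -/
theorem exists_top (n : Pt) (P : Finset Pt) {v : Pt} (hv : total v = 0) :
    ∃ p, proj p = v ∧ p ∈ ideal n P ∧ ∀ m : ℤ, 0 < m → (p + fun _ => m) ∉ ideal n P := by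
  obtain ⟨p, hp⟩ := exists_proj_eq hv
  obtain ⟨m, hm, hmax⟩ := Int.exists_greatest_of_bdd
    (P := fun m => (p + fun _ => m) ∈ ideal n P) ⟨n 0 - p 0, fun m hm => by
      have := hm.1 0
      simp at this
      -- A point so far down the diagonal that it lies below all the bounds `n i` and behind the
      -- wall of coordinate `0`.
      omega⟩ ⟨-(|p 0| + |p 1| + |p 2| + |n 0| + |n 1| + |n 2|), by
      have h1 := abs_le.mp (le_refl |p 0|)
      have h2 := abs_le.mp (le_refl |p 1|)
      have h3 := abs_le.mp (le_refl |p 2|)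
      have h4 := abs_le.mp (le_refl |n 0|)
      have h5 := abs_le.mp (le_refl |n 1|)
      have h6 := abs_le.mp (le_refl |n 2|)
      refine ⟨fun i => ?_, Or.inr ⟨0, ?_⟩⟩
      · obtain rfl | rfl | rfl := fin3_cases i <;> simp only [Pi.add_apply] <;> omega
      · simp only [Pi.add_apply]; omega⟩
  refine ⟨p + fun _ => m, ?_, hm, fun m' hm' h => ?_⟩
  · rw [← hp]
    funext i
    simp [proj]
  · have := hmax (m + m') (by convert h using 1; funext i; simp [add_assoc])
    omega

theorem IsPP.ht_eq (hP : IsPP n P) {p : Pt} (hp : p ∈ ideal n P) (hp' : p + 1 ∉ ideal n P) :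
    ht n P (proj p) = total p := by
  refine IsGreatest.csSup_eq ⟨⟨p, hp, rfl, rfl⟩, ?_⟩
  rintro s ⟨q, hq, hqp, rfl⟩
  obtain ⟨m, rfl⟩ := proj_eq_proj hqp.symm
  by_contra hlt
  have hm : 1 ≤ m := by
    simp [total] at hlt
    omega
  exact hp' (hP.isLowerSet (fun i => by simpa using hm) hq)

/-- A lower set meets each diagonal in everything below its top; so the heights determine the ideal
and thereby `P`. -/
theorem IsPP.mem_ideal_iff (hP : IsPP n P) {p : Pt} :
    p ∈ ideal n P ↔ total p ≤ ht n P (proj p) := by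
  obtain ⟨q, hqp, hq, hmax⟩ := exists_top n P (total_proj p)
  have hq1 : q + 1 ∉ ideal n P := hmax 1 one_pos
  rw [← hqp, hP.ht_eq hq hq1]
  obtain ⟨m, rfl⟩ := proj_eq_proj hqp
  constructor
  · intro h
    have : ¬ 0 < m := fun hm => hmax m hm h
    simp [total]
    omega
  · intro h
    refine hP.isLowerSet (fun i => ?_) hq
    simp [total] at h ⊢
    omega

/-- If the height rose by more than one, the top over the neighbouring point would dominate `q + 1`,
where `q` is the top over `v`. The congruence holds because the expression equals `3 * q 0`. -/
theorem IsPP.isHeight (hP : IsPP n P) : IsHeight (ht n P) := by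
  constructor
  · intro v hv k
    obtain ⟨q, hqp, hq, hmax⟩ := exists_top n P hv
    have hq1 : q + 1 ∉ ideal n P := hmax 1 one_pos
    rw [← hqp, hP.ht_eq hq hq1]
    have e : proj q + unitVec (k + 2) - unitVec (k + 1) = proj (q + unitVec k) := by
      rw [proj_add, proj_unitVec]; abel
    obtain ⟨r, hrp, hr, hrmax⟩ := exists_top n P (total_proj (q + unitVec k))
    have hr1 : r + 1 ∉ ideal n P := hrmax 1 one_pos
    rw [e, ← hrp, hP.ht_eq hr hr1]
    by_contra hlt
    obtain ⟨m, rfl⟩ := proj_eq_proj hrp.symm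
    have ht1 : total (q + unitVec k + fun _ => m) = total q + 1 + 3 * m := by
      rw [total_add, total_add, total_unitVec]
      simp [total]; ring
    have hm : 1 ≤ m := by omega
    refine hq1 (hP.isLowerSet (fun i => ?_) hr)
    simp only [Pi.add_apply, Pi.one_apply, unitVec_apply]
    split_ifs <;> omega
  · intro v hv
    obtain ⟨q, hqp, hq, hmax⟩ := exists_top n P hv
    have hq1 : q + 1 ∉ ideal n P := hmax 1 one_pos
    rw [← hqp, hP.ht_eq hq hq1]
    simp [proj, total]
    omega

theorem interior_proj {p : Pt} (hp : p ∈ Finset.Icc (1 - n) n) : Interior n (proj p) := by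
  rw [mem_box] at hp
  intro i
  have h1 := hp (i + 1)
  have h2 := hp (i + 2)
  simp only [proj, hexL]
  omega

/-- Diagonals over such points miss the box, so only the walls determine the height. -/
theorem ht_frozen (hP : IsPP n P) (hQ : IsPP n Q) {v : Pt} (hv : ¬ Interior n v) :
    ht n P v = ht n Q v := by
  unfold ht
  congr 1
  ext s
  have : ∀ p, proj p = v → ∀ R, IsPP n R → p ∉ R := by
    rintro p rfl R hR hp
    exact hv (interior_proj (hR.1 hp))
  refine exists_congr fun p => ?_
  constructor <;> rintro ⟨⟨h1, h2⟩, h3, h4⟩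
  · exact ⟨⟨h1, h2.imp (fun h => (this p h3 P hP h).elim) id⟩, h3, h4⟩
  · exact ⟨⟨h1, h2.imp (fun h => (this p h3 Q hQ h).elim) id⟩, h3, h4⟩

/-- No lozenge sticks out of the hexagon: on its boundary the top `q` lies behind the wall of
coordinate `k + 1`, so `q + unitVec k` is still in the ideal and the height cannot drop. -/
theorem IsPP.dir_valid (hP : IsPP n P) {t : Pt} (ht' : t ∈ hexagon n) :
    t (dir (ht n P) t) ≠ -hexL n (dir (ht n P) t) := by
  intro hk
  rw [mem_hexagon] at ht'
  have hlt := (hP.isHeight.dir_iff ht'.1).mp rfl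
  generalize dir (ht n P) t = k at *
  have hv : total (t + unitVec (k + 1)) = 0 := by
    rw [total_add, total_unitVec, ht'.1]; rfl
  obtain ⟨q, hqp, hq, hmax⟩ := exists_top n P hv
  have hq1 : q + 1 ∉ ideal n P := hmax 1 one_pos
  have e : t + unitVec (k + 2) = proj (q + unitVec k) := by
    rw [proj_add, proj_unitVec, hqp]; abel
  rw [e, ← hqp, hP.ht_eq hq hq1] at hlt
  have hnot : q + unitVec k ∉ ideal n P := by
    rw [hP.mem_ideal_iff, total_add, total_unitVec]
    omega
  apply hnot
  have h0 := congrFun hqp 0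
  have h1 := congrFun hqp 1
  have h2 := congrFun hqp 2
  have b0 := ht'.2 0
  have b1 := ht'.2 1
  have b2 := ht'.2 2
  have c0 := hq.1 0
  have c1 := hq.1 1
  have c2 := hq.1 2
  refine ⟨fun i => ?_, Or.inr ⟨k + 1, ?_⟩⟩
  · obtain rfl | rfl | rfl := fin3_cases k <;> obtain rfl | rfl | rfl := fin3_cases i <;>
      simp [proj, unitVec_apply, hexL] at * <;> omega
  · obtain rfl | rfl | rfl := fin3_cases k <;> simp [proj, unitVec_apply, hexL] at * <;> omega

theorem IsPP.ext_ht (hP : IsPP n P) (hQ : IsPP n Q)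
    (h : ∀ v, total v = 0 → ht n P v = ht n Q v) : P = Q := by
  ext p
  rw [hP.mem_iff, hQ.mem_iff, hP.mem_ideal_iff, hQ.mem_ideal_iff, h _ (total_proj p)]

theorem IsPP.ext_dir (hP : IsPP n P) (hQ : IsPP n Q)
    (h : ∀ t ∈ hexagon n, dir (ht n P) t = dir (ht n Q) t) : P = Q := by
  refine hP.ext_ht hQ ?_
  -- Directions determine increments, so agreement spreads from the frozen boundary by induction on
  -- the distance from the side `v 0 = -hexL n 0`.
  have key : ∀ m : ℕ, ∀ v, total v = 0 → v 0 + hexL n 0 ≤ m → ht n P v = ht n Q v := by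
    intro m
    induction m with
    | zero =>
      intro v _ hm
      refine ht_frozen hP hQ fun hi => ?_
      have := hi 0
      push_cast at hm
      omega
    | succ m ih =>
      intro v hv hm
      by_cases hi : Interior n v
      · have htot : total (v - unitVec 0) = -1 := by
          rw [total_sub, total_unitVec, hv]; rfl
        have hmem : v - unitVec 0 ∈ hexagon n := by
          refine mem_hexagon.mpr ⟨htot, fun i => ?_⟩
          have := hi i
          simp only [Pi.sub_apply, unitVec_apply]
          split_ifs <;> omega
        have h1 := hP.isHeight.increment htot 1
        have h2 := hQ.isHeight.increment htot 1
        rw [h _ hmem, ← h2] at h1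
        have h3 := ih (v - unitVec 0 + unitVec 2) (by
          rw [total_add, total_unitVec, htot]; rfl) (by
          simp [unitVec_apply]
          push_cast at hm
          omega)
        simp at h1 h3
        omega
      · exact ht_frozen hP hQ hi
  intro v hv
  exact key (v 0 + hexL n 0).toNat v hv (by omega)

end Ideal

/-- A closed discrete one-form supported in the hexagon has a potential vanishing outside. -/
theorem exists_potential (n : Pt) (δ : Fin 3 → Pt → ℤ)
    (hblack : ∀ t, total t = -1 → δ 0 t + δ 1 t + δ 2 t = 0)
    (hwhite : ∀ t, total t = -1 → δ 0 (nbr 0 t) + δ 1 (nbr 1 t) + δ 2 (nbr 2 t) = 0)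
    (hsupp : ∀ k t, δ k t ≠ 0 → -hexL n k < t k ∧ t k < hexL n k ∧ -hexL n 0 ≤ t 0) :
    ∃ N : Pt → ℤ, (∀ t, total t = -1 → ∀ k, N (t + unitVec (k + 2)) - N (t + unitVec (k + 1)) = δ k t) ∧
      ∀ v, total v = 0 → ¬ Interior n v → N v = 0 := by
  set K := hexL n 0 with hK
  let tr : ℤ → ℤ → Pt := fun x y => ![x, y, -1 - x - y]
  -- The potential integrates `δ 1` along rows, starting where coordinate `0` is `-K`; closedness
  -- then gives the other increments.
  let M : ℤ → ℤ → ℤ := fun x y => ∑ i ∈ range (x + K).toNat, δ 1 (tr (-K + i) y)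
  have htr : ∀ x y, total (tr x y) = -1 := fun x y => by simp [total, tr]
  have htr' : ∀ t, total t = -1 → t = tr (t 0) (t 1) := fun t ht => by
    refine pt_ext ?_ ?_ ?_ <;> simp [tr]
    simp only [total] at ht
    omega
  have hM0 : ∀ x y, x ≤ -K → M x y = 0 := fun x y hx => by
    simp [M, show (x + K).toNat = 0 by omega]
  have hM1 : ∀ x y, M (x + 1) y - M x y = δ 1 (tr x y) := by
    intro x y
    by_cases hx : -K ≤ x
    · simp only [M]
      rw [show (x + 1 + K).toNat = (x + K).toNat + 1 by omega, sum_range_succ,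
        show -K + ((x + K).toNat : ℤ) = x by omega]
      ring
    · rw [hM0 _ _ (by omega), hM0 _ _ (by omega)]
      by_contra hne
      have := (hsupp 1 (tr x y) (fun h => hne (by omega))).2.2
      simp [tr] at this
      omega
  have hM2 : ∀ x y, M x y - M x (y + 1) = δ 0 (tr x y) := by
    intro x y
    by_cases hx : -K ≤ x
    · induction x, hx using Int.leInduction with
      | base =>
        rw [hM0 _ _ le_rfl, hM0 _ _ le_rfl]
        by_contra hne
        have := (hsupp 0 (tr (-K) y) (fun h => hne (by omega))).1
        simp [tr] at this
        omega
      | succ x hx ih =>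
        have h1 := hM1 x y
        have h2 := hM1 x (y + 1)
        have h3 := hblack (tr x y) (htr x y)
        -- The reflected label of the white triangle adjacent to the three triangles in `e0`, `e1`,
        -- `e2`.
        let X : Pt := ![-(x + 1), -(y + 1), 1 + x + y]
        have hX : total X = -1 := by simp [total, X]; ring
        have h4 := hwhite X hX
        have e0 : nbr 0 X = tr (x + 1) y := by
          refine pt_ext ?_ ?_ ?_ <;> simp [nbr, X, tr, unitVec_apply]; ring
        have e1 : nbr 1 X = tr x (y + 1) := by
          refine pt_ext ?_ ?_ ?_ <;> simp [nbr, X, tr, unitVec_apply]; ring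
        have e2 : nbr 2 X = tr x y := by
          refine pt_ext ?_ ?_ ?_ <;> simp [nbr, X, tr, unitVec_apply]; ring
        rw [e0, e1, e2] at h4
        omega
    · rw [hM0 _ _ (by omega), hM0 _ _ (by omega)]
      by_contra hne
      have := (hsupp 0 (tr x y) (fun h => hne (by omega))).2.2
      simp [tr] at this
      omega
  let N : Pt → ℤ := fun v => M (v 0) (v 1)
  have hstep : ∀ t, total t = -1 → ∀ k,
      N (t + unitVec (k + 2)) - N (t + unitVec (k + 1)) = δ k t := by
    intro t ht k
    have h1 := hM1 (t 0) (t 1)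
    have h2 := hM2 (t 0) (t 1)
    have h3 := hblack t ht
    rw [← htr' t ht] at h1 h2
    obtain rfl | rfl | rfl := fin3_cases k <;> simp [N, unitVec_apply] <;> omega
  -- Outside the strip of coordinate `i` the form vanishes on the sides in direction `i`, so `N` is
  -- constant on those lines; following them reaches the region where `N` is already known to
  -- vanish.
  have hconst : ∀ i v, total v = 0 → ¬ (-hexL n i < v i ∧ v i < hexL n i) → ∀ m : ℕ,
      N (v + fun j => m * (unitVec (i + 2) j - unitVec (i + 1) j)) = N v ∧
      N (v - fun j => m * (unitVec (i + 2) j - unitVec (i + 1) j)) = N v := by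
    intro i v hv hi m
    have hz : ∀ a : ℤ, N (v + fun j => (a + 1) * (unitVec (i + 2) j - unitVec (i + 1) j)) =
        N (v + fun j => a * (unitVec (i + 2) j - unitVec (i + 1) j)) := by
      intro a
      set t : Pt := v + (fun j => a * (unitVec (i + 2) j - unitVec (i + 1) j)) - unitVec (i + 1) with ht
      have htt : total t = -1 := by
        rw [ht, total_sub, total_add, hv, total_unitVec]
        have : total (fun j => a * (unitVec (i + 2) j - unitVec (i + 1) j)) =
          a * (total (unitVec (i + 2)) - total (unitVec (i + 1))) := by simp only [total]; ring
        rw [this, total_unitVec, total_unitVec]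
        ring
      have hti : t i = v i := by
        obtain rfl | rfl | rfl := fin3_cases i <;> simp [ht, unitVec_apply]
      have h := hstep t htt i
      have h0 : δ i t = 0 := by
        by_contra hne
        have := hsupp i t hne
        rw [hti] at this
        exact hi ⟨this.1, this.2.1⟩
      have e1 : t + unitVec (i + 2) = v + fun j => (a + 1) * (unitVec (i + 2) j - unitVec (i + 1) j) := by
        funext j; simp [ht]; ring
      have e2 : t + unitVec (i + 1) = v + fun j => a * (unitVec (i + 2) j - unitVec (i + 1) j) := by
        funext j; simp [ht]
      rw [e1, e2, h0] at h
      omega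
    constructor
    · induction m with
      | zero => congr 1; funext j; simp
      | succ m ih =>
        rw [← ih, ← hz m]
        push_cast
        rfl
    · induction m with
      | zero => congr 1; funext j; simp
      | succ m ih =>
        rw [← ih]
        have := hz (-((m : ℤ) + 1))
        have e1 : (v - fun j => ((m + 1 : ℕ) : ℤ) * (unitVec (i + 2) j - unitVec (i + 1) j)) =
          v + fun j => (-((m : ℤ) + 1)) * (unitVec (i + 2) j - unitVec (i + 1) j) := by
          funext j; simp; ring
        have e2 : (v - fun j => (m : ℤ) * (unitVec (i + 2) j - unitVec (i + 1) j)) =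
          v + fun j => (-((m : ℤ) + 1) + 1) * (unitVec (i + 2) j - unitVec (i + 1) j) := by
          funext j; simp; ring
        rw [e1, e2, this]
  have hN0 : ∀ v : Pt, v 0 ≤ -K → N v = 0 := fun v hv => hM0 _ _ hv
  have hv1 : ∀ v, total v = 0 → ¬ (-hexL n 1 < v 1 ∧ v 1 < hexL n 1) → N v = 0 := by
    intro v hv hi
    rw [← (hconst 1 v hv hi (v 0 + K).toNat).2]
    apply hN0
    simp [unitVec_apply]
    omega
  have hv2 : ∀ v, total v = 0 → ¬ (-hexL n 2 < v 2 ∧ v 2 < hexL n 2) → N v = 0 := by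
    intro v hv hi
    rw [← (hconst 2 v hv hi (v 0 + K).toNat).1]
    apply hN0
    simp [unitVec_apply]
    omega
  have hv0 : ∀ v, total v = 0 → ¬ (-hexL n 0 < v 0 ∧ v 0 < hexL n 0) → N v = 0 := by
    intro v hv hi
    rw [← (hconst 0 v hv hi (v 1 + hexL n 1).toNat).1]
    apply hv1
    · rw [total_add, hv]
      simp [total, unitVec_apply]
    · simp [unitVec_apply]
      omega
  refine ⟨N, hstep, fun v hv hi => ?_⟩
  simp only [Interior, not_forall] at hi
  obtain ⟨i, hi⟩ := hi
  obtain rfl | rfl | rfl := fin3_cases i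
  · exact hv0 v hv hi
  · exact hv1 v hv hi
  · exact hv2 v hv hi

end BoxPP

/-! ### From perfect matchings of the hexagon back to plane partitions. -/

namespace BoxPP

open Finset

/-- The indicator of `t` being matched in direction `k`. -/
noncomputable def edgeInd (n : Pt) (f : Pt → Fin 3) (k : Fin 3) (t : Pt) : ℤ :=
  if t ∈ hexagon n ∧ f t = k then 1 else 0

theorem edgeInd_black (n : Pt) (f : Pt → Fin 3) (t : Pt) :
    edgeInd n f 0 t + edgeInd n f 1 t + edgeInd n f 2 t = if t ∈ hexagon n then 1 else 0 := by
  by_cases h : t ∈ hexagon n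
  · obtain hk | hk | hk := fin3_cases (f t) <;> simp [edgeInd, h, hk]
  · simp [edgeInd, h]

theorem edgeInd_white {n : Pt} {f : Pt → Fin 3}
    (hv : ∀ t ∈ hexagon n, t (f t) ≠ -hexL n (f t))
    (hinj : ∀ t ∈ hexagon n, ∀ t' ∈ hexagon n, nbr (f t) t = nbr (f t') t' → t = t') (x : Pt) :
    edgeInd n f 0 (nbr 0 x) + edgeInd n f 1 (nbr 1 x) + edgeInd n f 2 (nbr 2 x) =
      if x ∈ hexagon n then 1 else 0 := by
  by_cases h : x ∈ hexagon n
  · obtain ⟨t, ht, htx⟩ := Finset.surj_on_of_inj_on_of_card_le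
      (s := hexagon n) (t := hexagon n) (fun t _ => nbr (f t) t)
      (fun t ht => nbr_mem_hexagon ht (hv t ht)) (fun t t' ht ht' h => hinj t ht t' ht' h) le_rfl x h
    have hiff : ∀ k, (nbr k x ∈ hexagon n ∧ f (nbr k x) = k) ↔ k = f t := by
      intro k
      constructor
      · rintro ⟨h1, h2⟩
        have := hinj _ h1 t ht (by rw [h2, nbr_nbr, htx])
        rw [← this, h2]
      · rintro rfl
        rw [htx, nbr_nbr]
        exact ⟨ht, rfl⟩
    simp only [edgeInd, hiff, if_pos h]
    obtain hk | hk | hk := fin3_cases (f t) <;> simp [hk]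
  · have hn : ∀ k, edgeInd n f k (nbr k x) = 0 := by
      intro k
      refine if_neg fun ⟨h1, h2⟩ => h ?_
      have h3 := hv _ h1
      rw [h2] at h3
      have := nbr_mem_hexagon h1 h3
      rwa [nbr_nbr] at this
    simp [hn, h]

/-- Every perfect matching of the triangles in the hexagon comes from a plane partition. -/
theorem exists_isPP (n : Pt) (f : Pt → Fin 3)
    (hv : ∀ t ∈ hexagon n, t (f t) ≠ -hexL n (f t))
    (hinj : ∀ t ∈ hexagon n, ∀ t' ∈ hexagon n, nbr (f t) t = nbr (f t') t' → t = t') :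
    ∃ P, IsPP n P ∧ ∀ t ∈ hexagon n, dir (ht n P) t = f t := by
  have hE := isPP_empty n
  set h₀ := ht n ∅ with hh0
  have H0 : IsHeight h₀ := hE.isHeight
  have hv0 : ∀ t ∈ hexagon n, t (dir h₀ t) ≠ -hexL n (dir h₀ t) := fun t ht => hE.dir_valid ht
  have hinj0 : ∀ t ∈ hexagon n, ∀ t' ∈ hexagon n,
      nbr (dir h₀ t) t = nbr (dir h₀ t') t' → t = t' := fun t ht t' ht' h =>
    H0.nbr_dir_injective (mem_hexagon.mp ht).1 (mem_hexagon.mp ht').1 h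
  -- The difference of the given matching and that of the empty plane partition is closed, since
  -- each covers every triangle of the hexagon once.
  obtain ⟨N, hN, hN0⟩ := exists_potential n
    (fun k t => edgeInd n (dir h₀) k t - edgeInd n f k t)
    (fun t _ => by
      have h1 := edgeInd_black n f t
      have h2 := edgeInd_black n (dir h₀) t
      omega)
    (fun t _ => by
      have h1 := edgeInd_white hv hinj t
      have h2 := edgeInd_white hv0 hinj0 t
      omega)
    (fun k t hne => by
      have : t ∈ hexagon n ∧ (dir h₀ t = k ∨ f t = k) := by
        by_contra hcon
        apply hne
        simp only [edgeInd]
        rw [if_neg (fun h => hcon ⟨h.1, Or.inl h.2⟩), if_neg (fun h => hcon ⟨h.1, Or.inr h.2⟩),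
          sub_zero]
      have h1 : t k ≠ -hexL n k := by
        rcases this.2 with rfl | rfl
        · exact hv0 t this.1
        · exact hv t this.1
      have h2 := (mem_hexagon.mp this.1).2 k
      have h3 := (mem_hexagon.mp this.1).2 0
      exact ⟨by omega, h2.2, h3.1⟩)
  -- The factor `3` is the gap between the increments `1` and `-2`.
  let H : Pt → ℤ := fun v => h₀ v + 3 * N v
  have hinc : ∀ t, total t = -1 → ∀ k, H (t + unitVec (k + 2)) - H (t + unitVec (k + 1)) =
      if t ∈ hexagon n then (if f t = k then -2 else 1) else (if dir h₀ t = k then -2 else 1) := by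
    intro t ht k
    have h1 := H0.increment ht k
    have h2 := hN t ht k
    simp only [H]
    by_cases hm : t ∈ hexagon n
    · simp only [hm, edgeInd, true_and, if_true] at h1 h2 ⊢
      split_ifs at * <;> omega
    · simp only [hm, edgeInd, false_and, if_false] at h1 h2 ⊢
      omega
  have HH : IsHeight H := by
    constructor
    · intro v hv k
      have ht : total (v - unitVec (k + 1)) = -1 := by
        rw [total_sub, total_unitVec, hv]; rfl
      have h1 := hinc _ ht k
      rw [show v - unitVec (k + 1) + unitVec (k + 2) = v + unitVec (k + 2) - unitVec (k + 1) by abel,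
        sub_add_cancel] at h1
      split_ifs at h1 <;> omega
    · intro v hv
      have := H0.cong v hv
      simp only [H]
      omega
  have hfr : ∀ v, total v = 0 → ¬ Interior n v → H v = h₀ v := fun v hv hi => by
    simp [H, hN0 v hv hi]
  let J : Set Pt := {p | total p ≤ H (proj p)}
  have hJ1 : ∀ p ∈ J, ∀ k, p - unitVec k ∈ J := by
    intro p hp k
    have h1 := HH.step _ (total_proj (p - unitVec k)) k
    have h2 : proj (p - unitVec k) + unitVec (k + 2) - unitVec (k + 1) = proj p := by
      rw [proj_sub, proj_unitVec]; abel
    rw [h2] at h1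
    have h3 : total p ≤ H (proj p) := hp
    change total (p - unitVec k) ≤ _
    rw [total_sub, total_unitVec]
    omega
  have hJ2 : ∀ m : ℕ, ∀ p ∈ J, ∀ k, p - m • unitVec k ∈ J := by
    intro m p hp k
    induction m with
    | zero => simpa using hp
    | succ m ih =>
      have := hJ1 _ ih k
      rwa [sub_sub, ← succ_nsmul] at this
  have hJ : IsLowerSet J := by
    intro p q hqp hp
    have h := hJ2 (p 2 - q 2).toNat _ (hJ2 (p 1 - q 1).toNat _ (hJ2 (p 0 - q 0).toNat _ hp 0) 1) 2
    have h0 : q 0 ≤ p 0 := hqp 0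
    have h1 : q 1 ≤ p 1 := hqp 1
    have h2 : q 2 ≤ p 2 := hqp 2
    convert h using 1
    refine pt_ext ?_ ?_ ?_ <;> simp [unitVec_apply] <;> omega
  have hE' : ∀ p, ¬ Interior n (proj p) → (p ∈ J ↔ p ∈ ideal n ∅) := by
    intro p hp
    rw [hE.mem_ideal_iff]
    change total p ≤ H (proj p) ↔ _
    rw [hfr _ (total_proj p) hp]
  have hnotint : ∀ (p : Pt) (i : Fin 3), (hexL n (i + 2) ≤ p i - p (i + 1) ∨
      p i - p (i + 1) ≤ -hexL n (i + 2)) → ¬ Interior n (proj p) := by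
    intro p i h hi
    have h1 := hi (i + 2)
    have e1 : i + 2 + 1 = i := by rw [add_assoc]; exact add_zero i
    have e2 : i + 2 + 2 = i + 1 := by rw [add_assoc]; rfl
    simp only [proj, e1, e2] at h1
    omega
  have hLi : ∀ i : Fin 3, hexL n (i + 2) = n i + n (i + 1) := by
    intro i
    have e1 : i + 2 + 1 = i := by rw [add_assoc]; exact add_zero i
    have e2 : i + 2 + 2 = i + 1 := by rw [add_assoc]; rfl
    simp only [hexL, e1, e2]
  -- Raising coordinate `i + 1` to its maximum moves the projection out of the interior, where `J`
  -- agrees with the walls; the next step lowers that coordinate for the same purpose.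
  have hEJ : ideal n ∅ ⊆ J := by
    intro p hp
    obtain ⟨hpn, hp2⟩ := id hp
    obtain ⟨i, hi⟩ := hp2.resolve_left (by simp)
    have hne : i ≠ i + 1 := by simp
    have hle : p ≤ Function.update p (i + 1) (n (i + 1)) := by
      intro j
      by_cases hj : j = i + 1
      · subst hj; simpa using hpn (i + 1)
      · simp [hj]
    refine hJ hle ((hE' _ (hnotint _ i (Or.inr ?_))).mpr ⟨fun j => ?_, Or.inr ⟨i, ?_⟩⟩)
    · rw [hLi, Function.update_self, Function.update_of_ne hne]
      omega
    · by_cases hj : j = i + 1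
      · subst hj; simp
      · simpa [hj] using hpn j
    · rwa [Function.update_of_ne hne]
  have hJn : ∀ p ∈ J, ∀ i, p i ≤ n i := by
    intro p hp i
    by_contra hlt
    have hne : i ≠ i + 1 := by simp
    have hle : Function.update p (i + 1) (min (p (i + 1)) (-n (i + 1))) ≤ p := by
      intro j
      by_cases hj : j = i + 1
      · subst hj; simp
      · simp [hj]
    have h1 := hJ hle hp
    rw [hE' _ (hnotint _ i (Or.inl ?_))] at h1
    · have := h1.1 i
      rw [Function.update_of_ne hne] at this
      exact hlt this
    · rw [hLi, Function.update_self, Function.update_of_ne hne]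
      omega
  classical
  let P : Finset Pt := (Finset.Icc (1 - n) n).filter fun p => p ∈ J
  have hP : IsPP n P := by
    refine ⟨filter_subset _ _, fun p hp q hq hqp => ?_⟩
    rw [mem_filter] at hp ⊢
    exact ⟨hq, hJ hqp hp.2⟩
  have hPJ : ∀ p, p ∈ ideal n P ↔ p ∈ J := by
    intro p
    constructor
    · rintro ⟨h1, h2 | h2⟩
      · exact (mem_filter.mp h2).2
      · exact hEJ ⟨h1, Or.inr h2⟩
    · intro hp
      refine ⟨hJn p hp, ?_⟩
      by_cases h : ∃ i, p i ≤ -n i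
      · exact Or.inr h
      push Not at h
      refine Or.inl (mem_filter.mpr ⟨mem_box.mpr fun i => ?_, hp⟩)
      have h1 := h i
      have h2 := hJn p hp i
      omega
  have hht : ∀ v, total v = 0 → ht n P v = H v := by
    intro v hv
    obtain ⟨q, hqp, hq, hmax⟩ := exists_top n P hv
    have hq1 : q + 1 ∉ ideal n P := hmax 1 one_pos
    rw [← hqp, hP.ht_eq hq hq1]
    rw [hPJ] at hq hq1
    have h1 : total q ≤ H (proj q) := hq
    have h2 : ¬ total (q + 1) ≤ H (proj (q + 1)) := hq1
    rw [proj_add, proj_one, add_zero, total_add, total_one] at h2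
    have h3 := HH.cong _ (total_proj q)
    simp [proj] at h3
    simp only [total] at h1 h2 ⊢
    omega
  refine ⟨P, hP, fun t htm => ?_⟩
  have htt := (mem_hexagon.mp htm).1
  rw [hP.isHeight.dir_iff htt]
  have hs : ∀ j, total (t + unitVec j) = 0 := fun j => by
    rw [total_add, total_unitVec, htt]; rfl
  rw [hht _ (hs _), hht _ (hs _)]
  have := hinc t htt (f t)
  rw [if_pos htm, if_pos rfl] at this
  omega

end BoxPP

/-! ### The quotient by rotations and the point reflection. -/

namespace BoxPP

open Finset

/-- The equivalence relation of lying in the same orbit under a group of rotations. -/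
def orbSetoid (G : AddSubgroup (Fin 3)) : Setoid Pt where
  r t t' := ∃ g ∈ G, rot g t = t'
  iseqv :=
    { refl := fun t => ⟨0, G.zero_mem, rot_zero t⟩
      symm := by
        rintro t _ ⟨g, hg, rfl⟩
        exact ⟨-g, G.neg_mem hg, by rw [rot_rot, neg_add_cancel, rot_zero]⟩
      trans := by
        rintro t _ _ ⟨g, hg, rfl⟩ ⟨g', hg', rfl⟩
        exact ⟨g' + g, G.add_mem hg' hg, by rw [rot_rot]⟩ }

/-- The chosen representative of the orbit of `t`. -/
noncomputable def rep (G : AddSubgroup (Fin 3)) (t : Pt) : Pt :=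
  (Quotient.mk (orbSetoid G) t).out

variable {G : AddSubgroup (Fin 3)} {n : Pt} {P Q : Finset Pt}

theorem rep_eq_rep_iff {t t' : Pt} : rep G t = rep G t' ↔ ∃ g ∈ G, rot g t = t' := by
  rw [rep, rep, Quotient.out_inj, Quotient.eq]
  rfl

theorem exists_rot_eq_rep (G : AddSubgroup (Fin 3)) (t : Pt) : ∃ g ∈ G, rot g t = rep G t := by
  have h : (orbSetoid G) t (rep G t) := by
    rw [← Quotient.eq, rep, Quotient.out_eq]
  exact h

theorem rep_rot {g : Fin 3} (hg : g ∈ G) (t : Pt) : rep G (rot g t) = rep G t :=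
  (rep_eq_rep_iff.mpr ⟨g, hg, rfl⟩).symm

theorem rep_rep (t : Pt) : rep G (rep G t) = rep G t := by
  obtain ⟨g, hg, h⟩ := exists_rot_eq_rep G t
  conv_lhs => rw [← h, rep_rot hg]

/-- The rotation taking `t` to its representative. -/
noncomputable def repRot (G : AddSubgroup (Fin 3)) (t : Pt) : Fin 3 :=
  (exists_rot_eq_rep G t).choose

theorem repRot_mem (t : Pt) : repRot G t ∈ G := (exists_rot_eq_rep G t).choose_spec.1

theorem rot_repRot (t : Pt) : rot (repRot G t) t = rep G t := (exists_rot_eq_rep G t).choose_spec.2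

theorem rot_left_injective {t : Pt} (ht : total t = -1) {g g' : Fin 3} (h : rot g t = rot g' t) :
    g = g' := by
  have h1 : rot (g' - g) (rot g t) = rot g t := by
    rw [rot_rot, sub_add_cancel, h]
  have := rot_eq_self_of_total (by rwa [total_rot]) h1
  rw [sub_eq_zero] at this
  exact this.symm

theorem repRot_rot {t : Pt} (ht : total t = -1) {g : Fin 3} (hg : g ∈ G) :
    repRot G (rot g t) + g = repRot G t :=
  rot_left_injective ht (by rw [← rot_rot, rot_repRot, rot_repRot, rep_rot hg])

theorem repRot_eq_zero {t : Pt} (ht : total t = -1) (h : rep G t = t) : repRot G t = 0 :=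
  rot_left_injective ht (by rw [rot_repRot, h, rot_zero])

/-- The box is invariant under the rotations in `G`. -/
def BoxInv (G : AddSubgroup (Fin 3)) (n : Pt) : Prop := ∀ g ∈ G, ∀ i, n (i + g) = n i

theorem BoxInv.hexL (hn : BoxInv G n) {g : Fin 3} (hg : g ∈ G) (i : Fin 3) :
    hexL n (i + g) = hexL n i := by
  rw [BoxPP.hexL, BoxPP.hexL, add_right_comm, hn g hg, add_right_comm, hn g hg]

theorem BoxInv.hexL_sub (hn : BoxInv G n) {g : Fin 3} (hg : g ∈ G) (i : Fin 3) :
    BoxPP.hexL n (i - g) = BoxPP.hexL n i := by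
  rw [sub_eq_add_neg, hn.hexL (G.neg_mem hg)]

theorem BoxInv.rot_mem (hn : BoxInv G n) {g : Fin 3} (hg : g ∈ G) {t : Pt} (ht : t ∈ hexagon n) :
    rot g t ∈ hexagon n := by
  rw [mem_hexagon] at ht ⊢
  refine ⟨by rw [total_rot, ht.1], fun i => ?_⟩
  rw [← hn.hexL hg]
  exact ht.2 (i + g)

theorem BoxInv.rep_mem (hn : BoxInv G n) {t : Pt} (ht : t ∈ hexagon n) : rep G t ∈ hexagon n := by
  rw [← rot_repRot]
  exact hn.rot_mem (repRot_mem t) ht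

open Classical in
/-- The representatives of the orbits of triangles. -/
noncomputable def vset (n : Pt) (G : AddSubgroup (Fin 3)) : Finset Pt :=
  (hexagon n).filter fun t => rep G t = t

open Classical in
/-- The edges of the quotient of the adjacency graph of the triangles. -/
noncomputable def eset (n : Pt) (G : AddSubgroup (Fin 3)) : Finset (Pt × Fin 3) :=
  (vset n G ×ˢ univ).filter fun e => e.1 e.2 ≠ -hexL n e.2

theorem mem_vset {t : Pt} : t ∈ vset n G ↔ t ∈ hexagon n ∧ rep G t = t := by
  simp [vset]

theorem mem_eset {e : Pt × Fin 3} :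
    e ∈ eset n G ↔ (e.1 ∈ hexagon n ∧ rep G e.1 = e.1) ∧ e.1 e.2 ≠ -hexL n e.2 := by
  simp [eset, mem_vset]

theorem total_vset (x : vset n G) : total x.1 = -1 :=
  (mem_hexagon.mp (mem_vset.mp x.2).1).1

theorem rep_mem_vset (hn : BoxInv G n) {t : Pt} (ht : t ∈ hexagon n) : rep G t ∈ vset n G :=
  mem_vset.mpr ⟨hn.rep_mem ht, rep_rep t⟩

theorem nbr_mem_of_mem_eset {e : Pt × Fin 3} (he : e ∈ eset n G) : nbr e.2 e.1 ∈ hexagon n :=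
  nbr_mem_hexagon (mem_eset.mp he).1.1 (mem_eset.mp he).2

/-- The quotient by `G` and the point reflection of the adjacency graph of the triangles. -/
noncomputable def net (hn : BoxInv G n) : SkewNet (vset n G) (eset n G) where
  src e := ⟨e.1.1, mem_vset.mpr (mem_eset.mp e.2).1⟩
  tgt e := ⟨rep G (nbr e.1.2 e.1.1), rep_mem_vset hn (nbr_mem_of_mem_eset e.2)⟩
  -- Moving the neighbour to its representative also rotates the direction of the edge, as in
  -- `rot_nbr`.
  rev e := ⟨(rep G (nbr e.1.2 e.1.1), e.1.2 - repRot G (nbr e.1.2 e.1.1)), by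
    have h1 := nbr_mem_of_mem_eset e.2
    refine mem_eset.mpr ⟨⟨hn.rep_mem h1, rep_rep _⟩, ?_⟩
    simp only
    rw [hn.hexL_sub (repRot_mem _), ← rot_repRot, rot, sub_add_cancel]
    exact nbr_valid (mem_eset.mp e.2).1.1⟩
  w e := wt e.1.2 e.1.1
  src_rev _ := rfl
  tgt_rev e := by
    refine Subtype.ext ?_
    simp only
    rw [← rot_repRot (nbr e.1.2 e.1.1), ← rot_nbr, nbr_nbr, rep_rot (repRot_mem _)]
    exact (mem_eset.mp e.2).1.2
  rev_rev e := by
    have h0 := (mem_eset.mp e.2).1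
    have e1 : nbr (e.1.2 - repRot G (nbr e.1.2 e.1.1)) (rep G (nbr e.1.2 e.1.1)) =
        rot (repRot G (nbr e.1.2 e.1.1)) e.1.1 := by
      rw [← rot_repRot (nbr e.1.2 e.1.1), ← rot_nbr, nbr_nbr]
    refine Subtype.ext (Prod.ext ?_ ?_)
    · simp only [e1, rep_rot (repRot_mem _)]
      exact h0.2
    · simp only [e1]
      have h1 := repRot_rot (mem_hexagon.mp h0.1).1 (repRot_mem (G := G) (nbr e.1.2 e.1.1))
      rw [repRot_eq_zero (mem_hexagon.mp h0.1).1 h0.2] at h1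
      rw [sub_sub, add_comm, h1, sub_zero]
  w_rev e := by
    have h0 := (mem_eset.mp e.2).1
    simp only
    rw [← rot_repRot (nbr e.1.2 e.1.1), wt_rot, wt_nbr (mem_hexagon.mp h0.1).1]
    push_cast
    rfl
  w_sq e := by exact_mod_cast wt_mul_self _ _

/-- `P` is invariant under the rotations in `G`. -/
def RotInv (G : AddSubgroup (Fin 3)) (P : Finset Pt) : Prop := ∀ g ∈ G, ∀ p, rot g p ∈ P ↔ p ∈ P

/-- The point reflection of the complement of `P` in the box. -/
noncomputable def compl (n : Pt) (P : Finset Pt) : Finset Pt :=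
  (Finset.Icc (1 - n) n).filter fun p => 1 - p ∉ P

/-- The image of `P` under a rotation. -/
def rotPP (g : Fin 3) (P : Finset Pt) : Finset Pt := P.image (rot (-g))

theorem mem_rotPP {g : Fin 3} {p : Pt} : p ∈ rotPP g P ↔ rot g p ∈ P := by
  rw [rotPP, mem_image]
  constructor
  · rintro ⟨q, hq, rfl⟩
    rwa [rot_rot, add_neg_cancel, rot_zero]
  · intro h
    exact ⟨_, h, by rw [rot_rot, neg_add_cancel, rot_zero]⟩

theorem BoxInv.rot_mem_box (hn : BoxInv G n) {g : Fin 3} (hg : g ∈ G) {p : Pt} :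
    rot g p ∈ Finset.Icc (1 - n) n ↔ p ∈ Finset.Icc (1 - n) n := by
  simp only [mem_box, rot]
  constructor
  · intro h i
    have := h (i - g)
    rwa [sub_add_cancel, ← hn g hg (i - g), sub_add_cancel] at this
  · intro h i
    rw [← hn g hg i]
    exact h (i + g)

theorem IsPP.rotPP (hn : BoxInv G n) {g : Fin 3} (hg : g ∈ G) (hP : IsPP n P) :
    IsPP n (rotPP g P) := by
  constructor
  · intro p hp
    rw [mem_rotPP] at hp
    exact (hn.rot_mem_box hg).mp (hP.1 hp)
  · intro p hp q hq hqp
    rw [mem_rotPP] at hp ⊢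
    exact hP.2 _ hp _ ((hn.rot_mem_box hg).mpr hq) fun i => hqp (i + g)

theorem mem_ideal_rotPP (hn : BoxInv G n) {g : Fin 3} (hg : g ∈ G) {p : Pt} :
    p ∈ ideal n (rotPP g P) ↔ rot g p ∈ ideal n P := by
  have e : ∀ (a : Fin 3 → Prop), (∀ i, a i) ↔ ∀ i, a (i + g) := fun a =>
    ⟨fun h i => h _, fun h i => by simpa using h (i - g)⟩
  have e' : ∀ (a : Fin 3 → Prop), (∃ i, a i) ↔ ∃ i, a (i + g) := fun a =>
    ⟨fun ⟨i, h⟩ => ⟨i - g, by simpa using h⟩, fun ⟨i, h⟩ => ⟨_, h⟩⟩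
  simp only [ideal, Set.mem_ofPred_eq, mem_rotPP, rot]
  rw [e fun i => p i ≤ n i, e' fun i => p i ≤ -n i]
  simp only [hn g hg]

theorem ht_rotPP (hn : BoxInv G n) {g : Fin 3} (hg : g ∈ G) (v : Pt) :
    ht n (rotPP g P) v = ht n P (rot g v) := by
  unfold ht
  congr 1
  ext s
  constructor
  · rintro ⟨p, hp, rfl, rfl⟩
    exact ⟨rot g p, (mem_ideal_rotPP hn hg).mp hp, (rot_proj _ _).symm, total_rot _ _⟩
  · rintro ⟨p, hp, hpv, rfl⟩
    have hr : rot g (rot (-g) p) = p := by rw [rot_rot, add_neg_cancel, rot_zero]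
    refine ⟨rot (-g) p, (mem_ideal_rotPP hn hg).mpr (by rwa [hr]), rot_injective g ?_, total_rot _ _⟩
    rw [rot_proj, hr, hpv]

theorem rotPP_eq_iff : (∀ g ∈ G, rotPP g P = P) ↔ RotInv G P := by
  refine forall₂_congr fun g _ => ?_
  rw [Finset.ext_iff]
  exact forall_congr' fun p => by rw [mem_rotPP]

theorem RotInv.ht_rot (hn : BoxInv G n) (hP : RotInv G P) {g : Fin 3} (hg : g ∈ G) (v : Pt) :
    ht n P (rot g v) = ht n P v := by
  rw [← ht_rotPP hn hg, rotPP_eq_iff.mpr hP g hg]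

theorem RotInv.dir_rot (hn : BoxInv G n) (hPP : IsPP n P) (hP : RotInv G P) {g : Fin 3} (hg : g ∈ G)
    {t : Pt} (ht' : total t = -1) : dir (ht n P) (rot g t) = dir (ht n P) t - g :=
  hPP.isHeight.dir_rot (fun v => hP.ht_rot hn hg v) ht'

theorem RotInv.dir_rep (hn : BoxInv G n) (hPP : IsPP n P) (hP : RotInv G P)
    {t : Pt} (ht' : total t = -1) :
    dir (ht n P) t = dir (ht n P) (rep G t) + repRot G t := by
  rw [← rot_repRot, hP.dir_rot hn hPP (repRot_mem t) ht', sub_add_cancel]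

/-- The matching of the quotient graph given by a plane partition. -/
noncomputable def sec (G : AddSubgroup (Fin 3)) (hP : IsPP n P) (x : vset n G) : eset n G :=
  ⟨(x.1, dir (ht n P) x.1), mem_eset.mpr ⟨mem_vset.mp x.2, hP.dir_valid (mem_vset.mp x.2).1⟩⟩

theorem sec_mem_matchings (hn : BoxInv G n) (hPP : IsPP n P) (hP : RotInv G P) :
    sec G hPP ∈ (net hn).matchings := by
  refine SkewNet.mem_matchings.mpr ⟨fun x => rfl, fun x y hxy => ?_⟩
  have h1 : rep G (nbr (dir (ht n P) x.1) x.1) = rep G (nbr (dir (ht n P) y.1) y.1) :=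
    congrArg Subtype.val hxy
  obtain ⟨g, hg, h2⟩ := rep_eq_rep_iff.mp h1
  rw [rot_nbr, ← hP.dir_rot hn hPP hg (total_vset x)] at h2
  have h3 := hPP.isHeight.nbr_dir_injective (by rw [total_rot, total_vset]) (total_vset y) h2
  have h4 : rep G x.1 = rep G y.1 := rep_eq_rep_iff.mpr ⟨g, hg, h3⟩
  rw [(mem_vset.mp x.2).2, (mem_vset.mp y.2).2] at h4
  exact Subtype.ext h4

theorem sec_injective (hn : BoxInv G n) (hPP : IsPP n P) (hP : RotInv G P) (hQQ : IsPP n Q)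
    (hQ : RotInv G Q) (h : sec G hPP = sec G hQQ) : P = Q := by
  refine hPP.ext_dir hQQ fun t ht' => ?_
  have htt := (mem_hexagon.mp ht').1
  rw [hP.dir_rep hn hPP htt, hQ.dir_rep hn hQQ htt]
  have := congrArg (fun e => e.1.2) (congrFun h ⟨rep G t, rep_mem_vset hn ht'⟩)
  simp only [sec] at this
  rw [this]

/-- The matching lifts to an equivariant direction field `D` on the hexagon, injective because
rotations act freely on triangles. The plane partition with these directions is invariant, since its
rotations have the same directions. -/
theorem sec_surjective (hn : BoxInv G n) {f : vset n G → eset n G} (hf : f ∈ (net hn).matchings) :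
    ∃ (P : Finset Pt) (hPP : IsPP n P), RotInv G P ∧ sec G hPP = f := by
  obtain ⟨hsrc, hinj⟩ := SkewNet.mem_matchings.mp hf
  have hsrc' : ∀ x, (f x).1.1 = x.1 := fun x => congrArg Subtype.val (hsrc x)
  classical
  let D : Pt → Fin 3 := fun t =>
    if h : t ∈ hexagon n then (f ⟨rep G t, rep_mem_vset hn h⟩).1.2 + repRot G t else 0
  have hD : ∀ t (h : t ∈ hexagon n), D t = (f ⟨rep G t, rep_mem_vset hn h⟩).1.2 + repRot G t :=
    fun t h => dif_pos h
  have hDrot : ∀ t ∈ hexagon n, ∀ g ∈ G, D (rot g t) = D t - g := by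
    intro t h g hg
    rw [hD _ (hn.rot_mem hg h), hD _ h, ← repRot_rot (mem_hexagon.mp h).1 hg]
    simp only [rep_rot hg]
    abel
  have hDv : ∀ t ∈ hexagon n, t (D t) ≠ -hexL n (D t) := by
    intro t h
    have h1 := (mem_eset.mp (f ⟨rep G t, rep_mem_vset hn h⟩).2).2
    rw [hsrc'] at h1
    simp only at h1
    rw [hD _ h, hn.hexL (repRot_mem t)]
    generalize (f ⟨rep G t, rep_mem_vset hn h⟩).1.2 = k at h1 ⊢
    rwa [← rot_repRot] at h1
  have hDtgt : ∀ t (h : t ∈ hexagon n), ((net hn).tgt (f ⟨rep G t, rep_mem_vset hn h⟩)).1 =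
      rep G (nbr (D t) t) := by
    intro t h
    have h1 : ((net hn).tgt (f ⟨rep G t, rep_mem_vset hn h⟩)).1 =
      rep G (nbr (f ⟨rep G t, rep_mem_vset hn h⟩).1.2 (f ⟨rep G t, rep_mem_vset hn h⟩).1.1) := rfl
    rw [h1, hsrc', ← rep_rot (repRot_mem (G := G) t) (nbr (D t) t), rot_nbr, rot_repRot, hD _ h,
      add_sub_cancel_right]
  have hDinj : ∀ t ∈ hexagon n, ∀ t' ∈ hexagon n, nbr (D t) t = nbr (D t') t' → t = t' := by
    intro t h t' h' heq
    have h1 := hinj (Subtype.ext ((hDtgt t h).trans ((congrArg (rep G) heq).trans (hDtgt t' h').symm)))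
    have h2 : rep G t = rep G t' := congrArg Subtype.val h1
    obtain ⟨g, hg, rfl⟩ := rep_eq_rep_iff.mp h2
    rw [hDrot t h g hg, ← rot_nbr] at heq
    have := rot_eq_self_of_total (total_nbr (mem_hexagon.mp h).1) heq.symm
    rw [this, rot_zero]
  obtain ⟨P, hPP, hdir⟩ := exists_isPP n D hDv hDinj
  have hP : RotInv G P := by
    refine rotPP_eq_iff.mp fun g hg => ?_
    refine (hPP.rotPP hn hg).ext_dir hPP fun t h => ?_
    have htt := (mem_hexagon.mp h).1
    have h1 := hdir _ (hn.rot_mem hg h)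
    have h2 := hdir _ h
    rw [hDrot t h g hg, ← h2, hPP.isHeight.dir_iff (by rw [total_rot, htt])] at h1
    rw [(hPP.rotPP hn hg).isHeight.dir_iff htt, ht_rotPP hn hg, ht_rotPP hn hg, rot_add, rot_add,
      rot_unitVec, rot_unitVec]
    convert h1 using 4 <;> abel
  refine ⟨P, hPP, hP, funext fun x => Subtype.ext (Prod.ext (hsrc' x).symm ?_)⟩
  have hx := mem_vset.mp x.2
  simp only [sec]
  rw [hdir _ hx.1, hD _ hx.1, repRot_eq_zero (total_vset x) hx.2, add_zero]
  simp only [hx.2]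

theorem mem_compl {p : Pt} : p ∈ compl n P ↔ p ∈ Finset.Icc (1 - n) n ∧ 1 - p ∉ P := by
  simp only [compl, mem_filter]

theorem reflect_mem_box {p : Pt} : 1 - p ∈ Finset.Icc (1 - n) n ↔ p ∈ Finset.Icc (1 - n) n := by
  simp only [mem_box, Pi.sub_apply, Pi.one_apply]
  exact forall_congr' fun i => by omega

theorem IsPP.compl (hP : IsPP n P) : IsPP n (compl n P) := by
  refine ⟨filter_subset _ _, fun p hp q hq hqp => ?_⟩
  rw [mem_compl] at hp ⊢
  exact ⟨hq, fun h => hp.2 (hP.2 _ h _ (reflect_mem_box.mpr hp.1) (sub_le_sub_left hqp 1))⟩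

/-- Over the closed hexagon a point behind one wall automatically satisfies all upper bounds; this
is what makes the walls symmetric under the reflection. -/
theorem mem_ideal_compl (h0 : ∀ i, 0 ≤ n i) {p : Pt}
    (hp : ∀ i, -hexL n i ≤ proj p i ∧ proj p i ≤ hexL n i) :
    p ∈ ideal n (compl n P) ↔ 1 - p ∉ ideal n P := by
  have hlohi : ∀ i, p i ≤ - n i → ∀ j, p j ≤ n j := by
    intro i hi j
    have a0 := hp 0
    have a1 := hp 1
    have a2 := hp 2
    have b0 := h0 0
    have b1 := h0 1
    have b2 := h0 2
    simp [proj, hexL] at a0 a1 a2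
    obtain rfl | rfl | rfl := fin3_cases i <;> obtain rfl | rfl | rfl := fin3_cases j <;> omega
  simp only [ideal, Set.mem_ofPred_eq, mem_compl, Pi.sub_apply, Pi.one_apply, mem_box]
  constructor
  · rintro ⟨h1, h2 | ⟨i, hi⟩⟩ ⟨h3, h4 | ⟨j, hj⟩⟩
    · exact h2.2 h4
    · have := h1 j
      omega
    · have := h3 i
      omega
    · have := h3 i
      omega
  · intro h
    by_cases hlo : ∃ i, p i ≤ - n i
    · obtain ⟨i, hi⟩ := hlo
      exact ⟨hlohi i hi, Or.inr ⟨i, hi⟩⟩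
    push Not at hlo h
    have h1 := h fun i => by
      have := hlo i
      omega
    have h2 : ∀ i, p i ≤ n i := fun i => by
      have := h1.2 i
      omega
    exact ⟨h2, Or.inl ⟨fun i => ⟨by have := hlo i; omega, h2 i⟩, h1.1⟩⟩

/-- If `q` is the top over `v`, then `-q = 1 - (q + 1)` lies in the complementary ideal and `1 - q`
does not, so `-q` is the top over `-v`. -/
theorem IsPP.ht_compl (hP : IsPP n P) (h0 : ∀ i, 0 ≤ n i) {v : Pt} (hv : total v = 0)
    (hv' : ∀ i, -hexL n i ≤ v i ∧ v i ≤ hexL n i) : ht n (BoxPP.compl n P) (-v) = - ht n P v := by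
  obtain ⟨q, hqp, hq, hmax⟩ := exists_top n P hv
  have hq1 : q + 1 ∉ ideal n P := hmax 1 one_pos
  rw [← hqp] at hv'
  have h1 : -q ∈ ideal n (BoxPP.compl n P) := by
    rw [mem_ideal_compl h0]
    · rwa [sub_neg_eq_add, add_comm]
    · intro i
      rw [proj_neg, Pi.neg_apply]
      have := hv' i
      omega
  have h2 : -q + 1 ∉ ideal n (BoxPP.compl n P) := by
    rw [mem_ideal_compl h0, not_not]
    · convert hq using 1
      abel
    · intro i
      rw [proj_add, proj_neg, proj_one, add_zero, Pi.neg_apply]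
      have := hv' i
      omega
  rw [← hqp, ← proj_neg, hP.compl.ht_eq h1 h2, hP.ht_eq hq hq1, total_neg]

theorem IsPP.dir_compl (hP : IsPP n P) (h0 : ∀ i, 0 ≤ n i) {t : Pt} (ht' : t ∈ hexagon n) :
    dir (ht n (BoxPP.compl n P)) (nbr (dir (ht n P) t) t) = dir (ht n P) t := by
  have htt := (mem_hexagon.mp ht').1
  have h1 := (hP.isHeight.dir_iff htt).mp rfl
  rw [hP.compl.isHeight.dir_iff (total_nbr htt)]
  generalize dir (ht n P) t = k at *
  have e1 : nbr k t + unitVec (k + 2) = -(t + unitVec (k + 1)) := by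
    rw [nbr, ← unitVec_add_add k]; abel
  have e2 : nbr k t + unitVec (k + 1) = -(t + unitVec (k + 2)) := by
    rw [nbr, ← unitVec_add_add k]; abel
  have hs : ∀ j, total (t + unitVec j) = 0 := fun j => by
    rw [total_add, total_unitVec, htt]; rfl
  have hb : ∀ j i, -hexL n i ≤ (t + unitVec j) i ∧ (t + unitVec j) i ≤ hexL n i := by
    intro j i
    have := (mem_hexagon.mp ht').2 i
    rw [Pi.add_apply, unitVec_apply]
    split_ifs <;> omega
  rw [e1, e2, hP.ht_compl h0 (hs _) (hb _), hP.ht_compl h0 (hs _) (hb _)]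
  omega

/-- By `dir_compl`, complementation reads each matched edge from its other end, so symmetry of the
matching says that `P` and its complement have the same directions. -/
theorem sec_mem_symMatchings_iff (hn : BoxInv G n) (h0 : ∀ i, 0 ≤ n i) (hPP : IsPP n P)
    (hP : RotInv G P) : sec G hPP ∈ (net hn).symMatchings ↔ compl n P = P := by
  have hsym : sec G hPP ∈ (net hn).symMatchings ↔
      ∀ t ∈ hexagon n, dir (ht n P) (nbr (dir (ht n P) t) t) = dir (ht n P) t := by
    rw [SkewNet.mem_symMatchings]
    have hx : ∀ x : vset n G, sec G hPP ((net hn).tgt (sec G hPP x)) = (net hn).rev (sec G hPP x) ↔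
        dir (ht n P) (nbr (dir (ht n P) x.1) x.1) = dir (ht n P) x.1 := by
      intro x
      have htot := total_nbr (k := dir (ht n P) x.1) (total_vset x)
      rw [hP.dir_rep hn hPP htot, Subtype.ext_iff, Prod.ext_iff, ← eq_sub_iff_add_eq]
      exact ⟨fun h => h.2, fun h => ⟨rfl, h⟩⟩
    constructor
    · rintro ⟨-, h⟩ t ht'
      have htt := (mem_hexagon.mp ht').1
      have h1 := (hx ⟨rep G t, rep_mem_vset hn ht'⟩).mp (h _)
      simp only at h1
      rw [← rot_repRot, hP.dir_rot hn hPP (repRot_mem t) htt, ← rot_nbr,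
        hP.dir_rot hn hPP (repRot_mem t) (total_nbr htt)] at h1
      exact sub_left_injective h1
    · intro h
      exact ⟨fun x => rfl, fun x => (hx x).mpr (h _ (mem_vset.mp x.2).1)⟩
  rw [hsym]
  constructor
  · intro h
    refine hPP.compl.ext_dir hPP fun t ht' => ?_
    have h1 := hPP.dir_compl h0 (nbr_mem_hexagon ht' (hPP.dir_valid ht'))
    rwa [h t ht', nbr_nbr] at h1
  · intro h t ht'
    have h1 := hPP.dir_compl h0 ht'
    rwa [h] at h1

end BoxPP

/-! ### Local moves around an orbit of lattice points. -/

namespace BoxPP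

open Finset

/-- `x` lies in the orbit of `v`. -/
def InOrb (G : AddSubgroup (Fin 3)) (v x : Pt) : Prop := ∃ g ∈ G, rot g v = x

variable {G : AddSubgroup (Fin 3)} {n : Pt} {P Q : Finset Pt}

/-- On points of sum zero, rotations preserve `v 1 - v 2` modulo `3`, whereas a nonzero difference
of unit vectors changes it. So the corners of a triangle lie in distinct orbits. -/
theorem eq_of_rot_sub_eq {v : Pt} (hv : total v = 0) {g j j' : Fin 3}
    (h : rot g v - v = unitVec j - unitVec j') : j = j' := by
  have h0 := congrFun h 0
  have h1 := congrFun h 1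
  have h2 := congrFun h 2
  simp only [total] at hv
  obtain rfl | rfl | rfl := fin3_cases g <;> obtain rfl | rfl | rfl := fin3_cases j <;>
    obtain rfl | rfl | rfl := fin3_cases j' <;> simp [rot, unitVec_apply] at h0 h1 h2 ⊢ <;> omega

theorem eq_zero_of_rot_eq {v : Pt} (hv : total v = 0) {g : Fin 3} (hg : g ≠ 0) (h : rot g v = v) :
    v = 0 := by
  have h0 := congrFun h 0
  have h1 := congrFun h 1
  have h2 := congrFun h 2
  simp only [total] at hv
  obtain rfl | rfl | rfl := fin3_cases g
  · exact absurd rfl hg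
  all_goals
    simp [rot] at h0 h1 h2
    refine pt_ext ?_ ?_ ?_ <;> simp <;> omega

theorem eq_zero_of_rot_eq_neg {v : Pt} (hv : total v = 0) {g : Fin 3} (h : rot g v = -v) :
    v = 0 := by
  have h0 := congrFun h 0
  have h1 := congrFun h 1
  have h2 := congrFun h 2
  simp only [total] at hv
  obtain rfl | rfl | rfl := fin3_cases g <;> simp [rot] at h0 h1 h2 <;>
    refine pt_ext ?_ ?_ ?_ <;> simp <;> omega

theorem InOrb.unique_corner {v t : Pt} (hv : total v = 0) {j j' : Fin 3}
    (h : InOrb G v (t + unitVec j)) (h' : InOrb G v (t + unitVec j')) : j = j' := by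
  obtain ⟨g, -, hg⟩ := h
  obtain ⟨g', -, hg'⟩ := h'
  refine eq_of_rot_sub_eq (v := rot g' v) (g := g - g') (by rw [total_rot, hv]) ?_
  rw [rot_rot, sub_add_cancel, hg, hg']
  abel

theorem sub_unitVec_mem_hexagon {v : Pt} (hv : total v = 0) (hi : Interior n v) (j : Fin 3) :
    v - unitVec j ∈ hexagon n := by
  refine mem_hexagon.mpr ⟨by rw [total_sub, total_unitVec, hv]; rfl, fun i => ?_⟩
  have := hi i
  simp only [Pi.sub_apply, unitVec_apply]
  split_ifs <;> omega

theorem Interior.neg {v : Pt} (hi : Interior n v) : Interior n (-v) := fun i => by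
  have := hi i
  simp only [Pi.neg_apply]
  omega

/-- The vertex of the quotient graph given by a triangle at the lattice point `v`. -/
noncomputable def corner (hn : BoxInv G n) {v : Pt} (hv : total v = 0) (hi : Interior n v)
    (j : Fin 3) : vset n G :=
  ⟨rep G (v - unitVec j), rep_mem_vset hn (sub_unitVec_mem_hexagon hv hi j)⟩

theorem exists_eq_corner {hn : BoxInv G n} {v : Pt} {hv : total v = 0} {hi : Interior n v}
    {x : vset n G} {j : Fin 3} (h : InOrb G v (x.1 + unitVec j)) :
    ∃ i, x = corner hn hv hi i := by
  obtain ⟨g, hg, h⟩ := h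
  refine ⟨j + g, Subtype.ext ?_⟩
  rw [← (mem_vset.mp x.2).2]
  symm
  refine rep_eq_rep_iff.mpr ⟨g, hg, ?_⟩
  rw [rot_sub, rot_unitVec, h, add_sub_cancel_right, add_sub_cancel_right]

theorem corner_eq_corner {hn : BoxInv G n} {v : Pt} {hv : total v = 0} {hi : Interior n v}
    {i j : Fin 3} (h : corner hn hv hi i = corner hn hv hi j) (hij : i ≠ j) :
    v = 0 ∧ i - j ∈ G := by
  have h0 : rep G (v - unitVec i) = rep G (v - unitVec j) := congrArg Subtype.val h
  obtain ⟨g, hg, h1⟩ := rep_eq_rep_iff.mp h0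
  rw [rot_sub, rot_unitVec, sub_eq_sub_iff_sub_eq_sub] at h1
  have h2 := eq_of_rot_sub_eq hv h1
  rw [h2, sub_self, sub_eq_zero] at h1
  have h3 : i - j = g := by rw [← h2]; abel
  refine ⟨eq_zero_of_rot_eq hv ?_ h1, h3 ▸ hg⟩
  rintro rfl
  exact hij (sub_eq_zero.mp h3)

theorem tgt_sec (hn : BoxInv G n) (hPP : IsPP n P) (hP : RotInv G P) {t : Pt} (ht' : t ∈ hexagon n) :
    ((net hn).tgt (sec G hPP ⟨rep G t, rep_mem_vset hn ht'⟩)).1 =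
      rep G (nbr (dir (ht n P) t) t) := by
  have h1 : ((net hn).tgt (sec G hPP ⟨rep G t, rep_mem_vset hn ht'⟩)).1 =
    rep G (nbr (dir (ht n P) (rep G t)) (rep G t)) := rfl
  rw [h1, ← rot_repRot t, hP.dir_rot hn hPP (repRot_mem t) (mem_hexagon.mp ht').1, ← rot_nbr,
    rep_rot (repRot_mem t)]

theorem w_sec (hn : BoxInv G n) (hPP : IsPP n P) (hP : RotInv G P) {t : Pt} (ht' : t ∈ hexagon n) :
    (net hn).w (sec G hPP ⟨rep G t, rep_mem_vset hn ht'⟩) = wt (dir (ht n P) t) t := by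
  have h1 : (net hn).w (sec G hPP ⟨rep G t, rep_mem_vset hn ht'⟩) =
    wt (dir (ht n P) (rep G t)) (rep G t) := rfl
  rw [h1, ← rot_repRot t, hP.dir_rot hn hPP (repRot_mem t) (mem_hexagon.mp ht').1, wt_rot]

theorem sec_congr (hPP : IsPP n P) (hQQ : IsPP n Q) {x : vset n G}
    (h : dir (ht n Q) x.1 = dir (ht n P) x.1) : sec G hQQ x = sec G hPP x :=
  Subtype.ext (Prod.ext rfl h)

theorem tgt_sec_corner (hn : BoxInv G n) (hPP : IsPP n P) (hP : RotInv G P) {v : Pt}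
    (hv : total v = 0) (hi : Interior n v) {i k j : Fin 3} (hd : dir (ht n P) (v - unitVec i) = k)
    (hijk : unitVec i + unitVec k + unitVec j = 1) :
    (net hn).tgt (sec G hPP (corner hn hv hi i)) =
      corner hn (by rw [total_neg, hv]; rfl) hi.neg j := by
  refine Subtype.ext ((tgt_sec hn hPP hP (sub_unitVec_mem_hexagon hv hi i)).trans ?_)
  change _ = rep G _
  rw [hd, nbr, ← hijk]
  congr 1
  abel

theorem add_two_add_two (i : Fin 3) : i + 2 + 2 = i + 1 := by rw [add_assoc]; rfl

theorem add_one_add_two (i : Fin 3) : i + 1 + 2 = i := by rw [add_assoc]; exact add_zero i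

theorem add_two_add_one (i : Fin 3) : i + 2 + 1 = i := by rw [add_assoc]; exact add_zero i

theorem add_one_add_one (i : Fin 3) : i + 1 + 1 = i + 2 := by rw [add_assoc]; rfl

theorem prod_eq_prod_fin {V : Type*} [Fintype V] [DecidableEq V] (c : Fin 3 → V)
    (hc : Function.Injective c) (η : V → ℚ) (h : ∀ x, (∀ i, x ≠ c i) → η x = 1) :
    ∏ x, η x = ∏ i, η (c i) := by
  rw [← Finset.prod_image (s := univ) (g := c) fun x _ y _ hxy => hc hxy]
  symm
  refine Finset.prod_subset (subset_univ _) fun x _ hx => h x fun i hi => hx ?_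
  rw [hi]
  exact mem_image_of_mem _ (mem_univ i)

/-- Adding an orbit of cubes to a plane partition changes the sign of its contribution to the
determinant exactly if the cubes lie on the main diagonal. -/
theorem det_secMat_flip (hn : BoxInv G n) (hPP : IsPP n P) (hP : RotInv G P) (hQQ : IsPP n Q)
    (hQ : RotInv G Q) {v : Pt} (hv : total v = 0) (hi : Interior n v)
    (h1 : ∀ x, InOrb G v x → ht n Q x = ht n P x + 3)
    (h2 : ∀ x, total x = 0 → ¬ InOrb G v x → ht n Q x = ht n P x) :
    ((net hn).secMat (sec G hQQ)).det =
      (if v = 0 then -1 else 1) * ((net hn).secMat (sec G hPP)).det := by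
  have hs : ∀ t j, total t = -1 → total (t + unitVec j) = 0 := fun t j h => by
    rw [total_add, total_unitVec, h]; rfl
  have F1 : ∀ t j, total t = -1 → InOrb G v (t + unitVec j) →
      dir (ht n P) t = j + 1 ∧ dir (ht n Q) t = j + 2 := by
    intro t j ht' hj
    refine hPP.isHeight.dir_flip hQQ.isHeight ht' j (h1 _ hj) (h2 _ (hs _ _ ht') fun h => ?_)
      (h2 _ (hs _ _ ht') fun h => ?_)
    · have := hj.unique_corner hv h
      simp at this
    · have := hj.unique_corner hv h
      simp at this
  have F2 : ∀ t, total t = -1 → (∀ j, ¬ InOrb G v (t + unitVec j)) →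
      dir (ht n Q) t = dir (ht n P) t := fun t ht' hj =>
    IsHeight.dir_congr fun j => h2 _ (hs _ _ ht') (hj j)
  have hm := sub_unitVec_mem_hexagon hv hi
  have F1' : ∀ i, dir (ht n P) (v - unitVec i) = i + 1 ∧ dir (ht n Q) (v - unitVec i) = i + 2 := by
    intro i
    refine F1 _ i (mem_hexagon.mp (hm i)).1 ⟨0, G.zero_mem, ?_⟩
    rw [rot_zero, sub_add_cancel]
  set c := corner hn hv hi with hc
  have hother : ∀ x, (∀ i, x ≠ c i) → sec G hQQ x = sec G hPP x := by
    intro x hx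
    refine sec_congr hPP hQQ (F2 _ (total_vset x) fun j hj => ?_)
    obtain ⟨i, hi'⟩ := exists_eq_corner (hn := hn) (hv := hv) (hi := hi) hj
    exact hx i hi'
  have tP : ∀ i, (net hn).tgt (sec G hPP (c i)) =
      corner hn (by rw [total_neg, hv]; rfl) hi.neg (i + 2) :=
    fun i => tgt_sec_corner hn hPP hP hv hi (F1' i).1 (unitVec_add_add i)
  have tQ : ∀ i, (net hn).tgt (sec G hQQ (c i)) =
      corner hn (by rw [total_neg, hv]; rfl) hi.neg (i + 1) :=
    fun i => tgt_sec_corner hn hQQ hQ hv hi (F1' i).2 (by rw [← unitVec_add_add i]; abel)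
  have wP : ∀ i, (net hn).w (sec G hPP (c i)) = wt (i + 1) (v - unitVec i) := fun i => by
    rw [← (F1' i).1]; exact w_sec hn hPP hP (hm i)
  have wQ : ∀ i, (net hn).w (sec G hQQ (c i)) = wt (i + 2) (v - unitVec i) := fun i => by
    rw [← (F1' i).2]; exact w_sec hn hQQ hQ (hm i)
  -- Generic case: the three triangles at `v` stay distinct in the quotient and the move is a
  -- three-cycle.
  by_cases hinj : Function.Injective c
  · obtain ⟨π, hsign, hπc, hπx⟩ := exists_three_cycle c hinj
    rw [SkewNet.det_secMat_of_comp (net hn) π hsign (f := sec G hPP) (f' := sec G hQQ)]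
    · congr 1
      rw [prod_eq_prod_fin c hinj]
      · simp only [wP, wQ]
        have := wt_flux hv
        exact_mod_cast this
      · intro x hx
        rw [hother x hx]
        exact (net hn).w_sq _
    · intro x
      by_cases hx : ∃ i, x = c i
      · obtain ⟨i, rfl⟩ := hx
        rw [hπc, tQ, tP, add_one_add_one]
      · push Not at hx
        rw [hπx x hx, hother x hx]
  · simp only [Function.Injective, not_forall] at hinj
    obtain ⟨i, j, hij, hne⟩ := hinj
    obtain ⟨hv0, hG⟩ := corner_eq_corner hij hne
    -- Otherwise `v` is the centre and `G` is everything; the three triangles become one vertex, and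
    -- the move replaces an edge by a parallel one of opposite sign.
    have hGall : ∀ g, g ∈ G := by
      intro g
      have hne' : i - j ≠ 0 := sub_ne_zero.mpr hne
      generalize i - j = a at *
      have e : ∀ g a : Fin 3, a ≠ 0 → g = 0 ∨ g = a ∨ g = a + a := by decide
      rcases e g a hne' with rfl | rfl | rfl
      · exact G.zero_mem
      · exact hG
      · exact G.add_mem hG hG
    have hc0 : ∀ (v' : Pt) (hv' : total v' = 0) (hi' : Interior n v') i, v' = 0 →
        corner hn hv' hi' i = corner hn hv' hi' 0 := by
      intro v' hv' hi' i h
      refine Subtype.ext (rep_eq_rep_iff.mpr ⟨i, hGall i, ?_⟩)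
      rw [h, rot_sub, rot_unitVec, sub_self]
      rfl
    rw [SkewNet.det_secMat_of_comp (net hn) 1 (by simp) (f := sec G hPP) (f' := sec G hQQ)]
    · congr 1
      rw [if_pos hv0, Finset.prod_eq_single (c 0)]
      · rw [wP, wQ, hv0]
        simp [wt, unitVec_apply, sg]
      · intro x _ hx
        rw [hother x fun i hxi => hx (by rw [hxi, hc, hc0 v hv hi i hv0])]
        exact (net hn).w_sq _
      · simp
    · intro x
      rw [Equiv.Perm.one_apply]
      by_cases hx : ∃ i, x = c i
      · obtain ⟨i, rfl⟩ := hx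
        rw [tQ, tP, hc0 _ _ _ _ (by rw [hv0, neg_zero]), hc0 _ _ _ (i + 2) (by rw [hv0, neg_zero])]
      · push Not at hx
        rw [hother x hx]

/-- Exchanging an orbit of cubes for the opposite one is a congruence by a matrix of determinant
one. -/
theorem exists_congr_flip (hn : BoxInv G n) (hPP : IsPP n P) (hP : RotInv G P)
    (hPs : sec G hPP ∈ (net hn).symMatchings) (hQQ : IsPP n Q)
    (hQ : RotInv G Q) (hQs : sec G hQQ ∈ (net hn).symMatchings)
    {v : Pt} (hv : total v = 0) (hi : Interior n v) (hv0 : v ≠ 0)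
    (h1 : ∀ x, InOrb G v x → ht n Q x = ht n P x + 3)
    (h1' : ∀ x, InOrb G (-v) x → ht n P x = ht n Q x + 3)
    (h2 : ∀ x, total x = 0 → ¬ InOrb G v x → ¬ InOrb G (-v) x → ht n Q x = ht n P x) :
    ∃ c : Matrix (vset n G) (vset n G) ℚ, c.det = 1 ∧
      c * (net hn).secMat (sec G hPP) * c.transpose = (net hn).secMat (sec G hQQ) := by
  have hvn : total (-v) = 0 := by rw [total_neg, hv]; rfl
  have hs : ∀ t j, total t = -1 → total (t + unitVec j) = 0 := fun t j h => by
    rw [total_add, total_unitVec, h]; rfl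
  -- One corner would rise and another would fall by `3`, changing their difference by `6`, but
  -- increments are only `1` or `-2`.
  have hdisj : ∀ t j j', total t = -1 → InOrb G v (t + unitVec j) →
      ¬ InOrb G (-v) (t + unitVec j') := by
    intro t j j' ht' hj hj'
    have e1 := h1 _ hj
    have e2 := h1' _ hj'
    have hjj : j ≠ j' := by
      rintro rfl
      omega
    have a0 := hPP.isHeight.black ht' 0
    have a1 := hPP.isHeight.black ht' 1
    have a2 := hPP.isHeight.black ht' 2
    have b0 := hQQ.isHeight.black ht' 0
    have b1 := hQQ.isHeight.black ht' 1
    have b2 := hQQ.isHeight.black ht' 2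
    obtain rfl | rfl | rfl := fin3_cases j <;> obtain rfl | rfl | rfl := fin3_cases j' <;>
      simp at a0 a1 a2 b0 b1 b2 e1 e2 hjj <;> omega
  have F1 : ∀ t j, total t = -1 → InOrb G v (t + unitVec j) →
      dir (ht n P) t = j + 1 ∧ dir (ht n Q) t = j + 2 := by
    intro t j ht' hj
    refine hPP.isHeight.dir_flip hQQ.isHeight ht' j (h1 _ hj)
      (h2 _ (hs _ _ ht') (fun h => ?_) (hdisj t j _ ht' hj))
      (h2 _ (hs _ _ ht') (fun h => ?_) (hdisj t j _ ht' hj))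
    · have := hj.unique_corner hv h
      simp at this
    · have := hj.unique_corner hv h
      simp at this
  have hm := sub_unitVec_mem_hexagon hv hi
  have hmn := sub_unitVec_mem_hexagon hvn hi.neg
  have D : ∀ i, dir (ht n P) (v - unitVec i) = i + 1 ∧ dir (ht n Q) (v - unitVec i) = i + 2 :=
    fun i => F1 _ i (mem_hexagon.mp (hm i)).1 ⟨0, G.zero_mem, by rw [rot_zero, sub_add_cancel]⟩
  set c := corner hn hv hi with hc
  set d := corner hn hvn hi.neg with hd
  have hcd : ∀ i j, c i ≠ d j := by
    intro i j hij
    have h0 : rep G (v - unitVec i) = rep G (-v - unitVec j) := congrArg Subtype.val hij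
    obtain ⟨g, hg, h3⟩ := rep_eq_rep_iff.mp h0
    rw [rot_sub, rot_unitVec] at h3
    refine hdisj (-v - unitVec j) (i - g) j (mem_hexagon.mp (hmn j)).1 ⟨g, hg, ?_⟩
      ⟨0, G.zero_mem, by rw [rot_zero, sub_add_cancel]⟩
    rw [← h3, sub_add_cancel]
  have hcinj : Function.Injective c := fun i j hij => by
    by_contra hne
    exact hv0 (corner_eq_corner hij hne).1
  have hdinj : Function.Injective d := fun i j hij => by
    by_contra hne
    exact hv0 (neg_eq_zero.mp (corner_eq_corner hij hne).1)
  have hother : ∀ x, (∀ i, x ≠ c i) → (∀ i, x ≠ d i) → sec G hQQ x = sec G hPP x := by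
    intro x hx hx'
    refine sec_congr hPP hQQ (IsHeight.dir_congr fun j => h2 _ (hs _ _ (total_vset x)) ?_ ?_)
    · intro hj
      obtain ⟨i, hi'⟩ := exists_eq_corner (hn := hn) (hv := hv) (hi := hi) hj
      exact hx i hi'
    · intro hj
      obtain ⟨i, hi'⟩ := exists_eq_corner (hn := hn) (hv := hvn) (hi := hi.neg) hj
      exact hx' i hi'
  have cP : ∀ i, (net hn).tgt (sec G hPP (c i)) = d (i + 2) :=
    fun i => tgt_sec_corner hn hPP hP hv hi (D i).1 (unitVec_add_add i)
  have cQ : ∀ i, (net hn).tgt (sec G hQQ (c i)) = d (i + 1) :=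
    fun i => tgt_sec_corner hn hQQ hQ hv hi (D i).2 (by rw [← unitVec_add_add i]; abel)
  have dP : ∀ i, (net hn).tgt (sec G hPP (d i)) = c (i + 1) := fun i => by
    rw [← SkewNet.tgt_tgt hPs (c (i + 1)), cP, add_one_add_two]
  have dQ : ∀ i, (net hn).tgt (sec G hQQ (d i)) = c (i + 2) := fun i => by
    rw [← SkewNet.tgt_tgt hQs (c (i + 2)), cQ, add_two_add_one]
  have wc : ∀ i, (net hn).w (sec G hPP (c i)) * (net hn).w (sec G hQQ (c i)) =
      ((wt (i + 1) (v - unitVec i) * wt (i + 2) (v - unitVec i) : ℤ) : ℚ) := fun i => by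
    push_cast
    congr 1
    · rw [← (D i).1]; exact w_sec hn hPP hP (hm i)
    · rw [← (D i).2]; exact w_sec hn hQQ hQ (hm i)
  have wdP : ∀ i, (net hn).w (sec G hPP (d i)) = - (net hn).w (sec G hPP (c (i + 1))) := fun i => by
    rw [← (net hn).w_rev, ← (SkewNet.mem_symMatchings.mp hPs).2, cP, add_one_add_two]
  have wdQ : ∀ i, (net hn).w (sec G hQQ (d i)) = - (net hn).w (sec G hQQ (c (i + 2))) := fun i => by
    rw [← (net hn).w_rev, ← (SkewNet.mem_symMatchings.mp hQs).2, cQ, add_two_add_one]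
  -- The partner of `c i` passes from `d (i + 2)` to `d (i + 1)`, so turning only the triangles at
  -- `-v` suffices; the negated index makes the cycle run `d j ↦ d (j + 2)`.
  obtain ⟨π, hsign, hπd, hπx⟩ := exists_three_cycle (fun j => d (-j)) (fun i j hij =>
    neg_injective (hdinj hij))
  have hπd' : ∀ j, π (d j) = d (j + 2) := fun j => by
    have := hπd (-j)
    simp only [neg_neg, neg_add_rev] at this
    rw [this, add_comm]
    rfl
  have hπx' : ∀ x, (∀ j, x ≠ d j) → π x = x := fun x hx => hπx x fun j => hx _
  classical
  -- The gauge at the `c i` absorbs the change of weights; its product is the flux at `v`, which is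
  -- `1` away from the centre.
  let η : vset n G → ℚ := fun x =>
    if ∃ i, x = c i then (net hn).w (sec G hPP x) * (net hn).w (sec G hQQ x) else 1
  have ηc : ∀ i, η (c i) = (net hn).w (sec G hPP (c i)) * (net hn).w (sec G hQQ (c i)) :=
    fun i => if_pos ⟨i, rfl⟩
  have ηx : ∀ x, (∀ i, x ≠ c i) → η x = 1 := fun x hx => if_neg fun ⟨i, h⟩ => hx i h
  have ηd : ∀ j, η (d j) = 1 := fun j => ηx _ fun i h => hcd i j h.symm
  refine SkewNet.exists_congr_of_conj (net hn) π hsign ?_ η ?_ ?_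
  · intro x
    by_cases hx : ∃ i, x = c i
    · obtain ⟨i, rfl⟩ := hx
      rw [hπx' _ (hcd i), cP, cQ, hπd', add_two_add_two]
    by_cases hx' : ∃ i, x = d i
    · obtain ⟨i, rfl⟩ := hx'
      rw [hπd', dP, dQ, hπx' _ (hcd _), add_two_add_two]
    push Not at hx hx'
    rw [hπx' x hx', hother x hx hx', hπx']
    intro j hj
    apply hx (j + 1)
    rw [← SkewNet.tgt_tgt hPs x, hj, dP]
  · rw [prod_eq_prod_fin c hcinj η ηx]
    simp only [ηc, wc]
    have := wt_flux hv
    rw [if_neg hv0] at this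
    exact_mod_cast this
  · intro x
    by_cases hx : ∃ i, x = c i
    · obtain ⟨i, rfl⟩ := hx
      rw [hπx' _ (hcd i), cP, ηd, ηc]
      linear_combination (- (net hn).w (sec G hQQ (c i))) * (net hn).w_sq (sec G hPP (c i))
    by_cases hx' : ∃ i, x = d i
    · obtain ⟨i, rfl⟩ := hx'
      rw [hπd', dP, wdP, wdQ, ηd, ηc, add_two_add_two]
      linear_combination ((net hn).w (sec G hQQ (c (i + 1)))) *
        (net hn).w_sq (sec G hPP (c (i + 1)))
    push Not at hx hx'
    rw [hπx' x hx', hother x hx hx', ηx x hx, ηx, one_mul, one_mul]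
    intro i hi'
    apply hx' (i + 2)
    rw [← SkewNet.tgt_tgt hPs x, hi', cP]

end BoxPP

/-! ### Connecting plane partitions by orbits of cubes. -/

namespace BoxPP

open Finset

variable {G : AddSubgroup (Fin 3)} {n : Pt} {P Q : Finset Pt}

open Classical in
/-- The orbit of a cube. -/
noncomputable def orb (G : AddSubgroup (Fin 3)) (p : Pt) : Finset Pt :=
  (univ.filter (· ∈ G)).image fun g => rot g p

theorem mem_orb {p q : Pt} : q ∈ orb G p ↔ ∃ g ∈ G, rot g p = q := by
  simp [orb]

theorem self_mem_orb (p : Pt) : p ∈ orb G p := mem_orb.mpr ⟨0, G.zero_mem, rot_zero p⟩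

theorem rot_mem_orb {g : Fin 3} (hg : g ∈ G) {p q : Pt} : rot g q ∈ orb G p ↔ q ∈ orb G p := by
  rw [mem_orb, mem_orb]
  constructor
  · rintro ⟨g', hg', h⟩
    refine ⟨-g + g', G.add_mem (G.neg_mem hg) hg', ?_⟩
    rw [← rot_rot, h, rot_rot, neg_add_cancel, rot_zero]
  · rintro ⟨g', hg', rfl⟩
    exact ⟨g + g', G.add_mem hg hg', (rot_rot _ _ _).symm⟩

theorem total_of_mem_orb {p q : Pt} (h : q ∈ orb G p) : total q = total p := by
  obtain ⟨g, -, rfl⟩ := mem_orb.mp h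
  exact total_rot g p

theorem reflect_mem_orb {p q : Pt} : 1 - q ∈ orb G p ↔ q ∈ orb G (1 - p) := by
  rw [mem_orb, mem_orb]
  refine exists_congr fun g => and_congr_right fun _ => ?_
  rw [rot_sub, rot_one]
  constructor <;> intro h
  · rw [h, sub_sub_cancel]
  · rw [← h, sub_sub_cancel]

theorem inOrb_proj_iff {p x : Pt} : InOrb G (proj p) x ↔ ∃ q ∈ orb G p, proj q = x := by
  constructor
  · rintro ⟨g, hg, rfl⟩
    exact ⟨_, mem_orb.mpr ⟨g, hg, rfl⟩, (rot_proj g p).symm⟩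
  · rintro ⟨q, hq, rfl⟩
    obtain ⟨g, hg, rfl⟩ := mem_orb.mp hq
    exact ⟨g, hg, rot_proj g p⟩

theorem eq_of_proj_eq {p q : Pt} (h : proj p = proj q) (ht : total p = total q) : p = q := by
  obtain ⟨m, rfl⟩ := proj_eq_proj h
  have : m = 0 := by
    simp [total] at ht
    omega
  subst this
  funext i
  simp

theorem RotInv.orb_subset (hP : RotInv G P) {p : Pt} (hp : p ∈ P) : orb G p ⊆ P := by
  intro q hq
  obtain ⟨g, hg, rfl⟩ := mem_orb.mp hq
  exact (hP g hg p).mpr hp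

theorem RotInv.disjoint_orb (hP : RotInv G P) {p : Pt} (hp : p ∉ P) {q : Pt} (hq : q ∈ orb G p) :
    q ∉ P := by
  obtain ⟨g, hg, rfl⟩ := mem_orb.mp hq
  rwa [hP g hg p]

theorem ht_congr {x : Pt} (h : ∀ q, proj q = x → (q ∈ Q ↔ q ∈ P)) : ht n Q x = ht n P x := by
  unfold ht
  congr 1
  ext s
  refine exists_congr fun q => ?_
  constructor <;> rintro ⟨⟨h1, h2⟩, h3, h4⟩
  · exact ⟨⟨h1, h2.imp (h q h3).mp id⟩, h3, h4⟩
  · exact ⟨⟨h1, h2.imp (h q h3).mpr id⟩, h3, h4⟩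

/-- The top of the diagonal moves from `p - 1` to `p`. -/
theorem ht_add_cube (hP : IsPP n P) (hQ : IsPP n Q) {p : Pt} (hpP : p ∉ P) (hpQ : p ∈ Q)
    (h : ∀ q, proj q = proj p → (q ∈ Q ↔ q ∈ P ∨ q = p)) :
    ht n Q (proj p) = ht n P (proj p) + 3 := by
  have hbox := mem_box.mp (hQ.1 hpQ)
  have hpI : p ∈ ideal n Q := (hQ.mem_iff.mp hpQ).2
  have hnlo : ∀ q, p ≤ q → ¬ ∃ i, q i ≤ -n i := by
    rintro q hq ⟨i, hi⟩
    have h1 := (hbox i).1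
    have h2 : p i ≤ q i := hq i
    omega
  have hle : p ≤ p + 1 := fun i => by simp
  have hle' : p - 1 ≤ p := fun i => by simp
  have hne : ∀ m : Pt, total m ≠ 0 → p + m ≠ p := fun m hm h => by
    have : m = 0 := by simpa using h
    rw [this] at hm
    simp [total] at hm
  have hp1 : p + 1 ∉ ideal n Q := by
    rintro ⟨h1, h2⟩
    have h3 := h2.resolve_right (hnlo _ hle)
    have h4 := ((h (p + 1) (by rw [proj_add, proj_one, add_zero])).mp h3).resolve_right
      (hne 1 (by simp [total]))
    exact hpP (hP.2 _ h4 _ (hQ.1 hpQ) hle)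
  have hq : p - 1 ∈ ideal n P := by
    obtain ⟨h1, h2⟩ := hQ.isLowerSet hle' hpI
    refine ⟨h1, h2.imp (fun h3 => ?_) id⟩
    refine ((h (p - 1) (by rw [proj_sub, proj_one, sub_zero])).mp h3).resolve_right ?_
    rw [sub_eq_add_neg]
    exact hne (-1) (by simp [total])
  have hq1 : p - 1 + 1 ∉ ideal n P := by
    rw [sub_add_cancel]
    rintro ⟨_, h2⟩
    exact h2.elim hpP (hnlo p le_rfl)
  have e := hP.ht_eq hq hq1
  rw [proj_sub, proj_one, sub_zero] at e
  rw [hQ.ht_eq hpI hp1, e, total_sub, total_one]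
  omega

/-- The sign of a cube: negative on the main diagonal. -/
noncomputable def cubeSign (p : Pt) : ℚ := if proj p = 0 then -1 else 1

/-- A cube on the main diagonal is alone in its orbit, so an orbit carries the same sign as the flux
in `det_secMat_flip`. -/
theorem prod_orb (p : Pt) : ∏ q ∈ orb G p, cubeSign q = if proj p = 0 then -1 else 1 := by
  by_cases h : proj p = 0
  · have : orb G p = {p} := by
      ext q
      rw [mem_singleton]
      constructor
      · intro hq
        refine eq_of_proj_eq ?_ (total_of_mem_orb hq)
        obtain ⟨g, -, rfl⟩ := mem_orb.mp hq
        rw [← rot_proj, h]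
        rfl
      · rintro rfl
        exact self_mem_orb q
    rw [this, prod_singleton, cubeSign]
  · rw [if_neg h]
    refine prod_eq_one fun q hq => ?_
    obtain ⟨g, -, rfl⟩ := mem_orb.mp hq
    rw [cubeSign, if_neg]
    rw [← rot_proj]
    intro h0
    exact h (rot_injective g h0)

/-- Induction on the number of cubes: the orbit of a maximal cube is removed, leaving an invariant
plane partition. -/
theorem det_secMat_sec (hn : BoxInv G n) : ∀ (m : ℕ) (P : Finset Pt) (hPP : IsPP n P),
    RotInv G P → P.card ≤ m → ((net hn).secMat (sec G hPP)).det =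
      (∏ q ∈ P, cubeSign q) * ((net hn).secMat (sec G (isPP_empty n))).det := by
  intro m
  induction m with
  | zero =>
    intro P hPP _ hm
    have : P = ∅ := by simpa using hm
    subst this
    simp
  | succ m ih =>
    intro P hPP hP hm
    rcases P.eq_empty_or_nonempty with rfl | hne
    · simp
    obtain ⟨p, hp⟩ := Finset.exists_maximal hne
    have hpP : p ∈ P := hp.prop
    have hsub := hP.orb_subset hpP
    have hQQ : IsPP n (P \ orb G p) := by
      refine ⟨sdiff_subset.trans hPP.1, fun r hr q hq hqr => ?_⟩
      rw [mem_sdiff] at hr ⊢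
      refine ⟨hPP.2 r hr.1 q hq hqr, fun hqo => ?_⟩
      obtain ⟨g, hg, rfl⟩ := mem_orb.mp hqo
      have h1 : rot (-g) r ∈ P := (hP _ (G.neg_mem hg) r).mpr hr.1
      have h2 : p ≤ rot (-g) r := fun i => by
        have : rot g p (i - g) ≤ r (i - g) := hqr (i - g)
        simpa [rot, sub_eq_add_neg] using this
      have h3 : p = rot (-g) r := le_antisymm h2 (hp.le_of_ge h1 h2)
      apply hr.2
      exact mem_orb.mpr ⟨g, hg, by rw [h3, rot_rot, add_neg_cancel, rot_zero]⟩
    have hQ : RotInv G (P \ orb G p) := fun g hg q => by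
      rw [mem_sdiff, mem_sdiff, hP g hg, rot_mem_orb hg]
    have hnot : ∀ q ∈ orb G p, q ∉ P \ orb G p := fun q hq h => (mem_sdiff.mp h).2 hq
    have hcard : (P \ orb G p).card ≤ m := by
      have h1 : (P \ orb G p).card < P.card := by
        refine card_lt_card ⟨sdiff_subset, fun h => ?_⟩
        exact hnot p (self_mem_orb p) (h hpP)
      omega
    have h := det_secMat_flip hn hQQ hQ hPP hP (total_proj p) (interior_proj (hPP.1 hpP))
      (fun x hx => by
        obtain ⟨q, hq, rfl⟩ := inOrb_proj_iff.mp hx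
        refine ht_add_cube hQQ hPP (hnot q hq) (hsub hq) fun r hr => ?_
        rw [mem_sdiff]
        constructor
        · intro hrP
          by_cases hro : r ∈ orb G p
          · exact Or.inr (eq_of_proj_eq hr ((total_of_mem_orb hro).trans (total_of_mem_orb hq).symm))
          · exact Or.inl ⟨hrP, hro⟩
        · rintro (h | rfl)
          · exact h.1
          · exact hsub hq)
      (fun x _ hx => ht_congr fun q hq => by
        rw [mem_sdiff]
        refine ⟨fun h => ⟨h, fun ho => hx (inOrb_proj_iff.mpr ⟨q, ho, hq⟩)⟩, fun h => h.1⟩)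
    rw [h, ih _ hQQ hQ hcard, ← prod_sdiff hsub, prod_orb]
    ring

/-- Induction on the cubes of `Q` missing from `P`: the orbit of a minimal one, `q`, is added to `P`
and the orbit of `1 - q` is removed, which brings `P` closer to `Q` and keeps it invariant and
self-complementary. -/
theorem exists_congr_sec (hn : BoxInv G n) (h0 : ∀ i, 0 ≤ n i) (hQQ : IsPP n Q) (hQ : RotInv G Q)
    (hQc : compl n Q = Q) : ∀ (m : ℕ) (P : Finset Pt) (hPP : IsPP n P), RotInv G P → compl n P = P →
      (Q \ P).card ≤ m → ∃ c : Matrix (vset n G) (vset n G) ℚ, c.det = 1 ∧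
        c * (net hn).secMat (sec G hPP) * c.transpose = (net hn).secMat (sec G hQQ) := by
  have hcmem : ∀ {R : Finset Pt}, compl n R = R → ∀ {r}, r ∈ Finset.Icc (1 - n) n →
      (r ∈ R ↔ 1 - r ∉ R) := by
    intro R hR r hr
    conv_lhs => rw [← hR, mem_compl]
    simp [hr]
  intro m
  have hbase : ∀ (P : Finset Pt) (hPP : IsPP n P), compl n P = P → Q ⊆ P →
      ∃ c : Matrix (vset n G) (vset n G) ℚ, c.det = 1 ∧
        c * (net hn).secMat (sec G hPP) * c.transpose = (net hn).secMat (sec G hQQ) := by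
    intro P hPP hPc hsub
    have : P = Q := by
      refine Subset.antisymm (fun p hp => ?_) hsub
      by_contra hpQ
      have h1 := hPP.1 hp
      rw [hcmem hQc h1, not_not] at hpQ
      exact (hcmem hPc h1).mp hp (hsub hpQ)
    subst this
    exact ⟨1, by simp, by simp⟩
  induction m with
  | zero =>
    intro P hPP _ hPc hm
    exact hbase P hPP hPc (by simpa using hm)
  | succ m ih =>
    intro P hPP hP hPc hm
    rcases (Q \ P).eq_empty_or_nonempty with he | hne
    · exact hbase P hPP hPc (sdiff_eq_empty_iff_subset.mp he)
    obtain ⟨q, hq⟩ := Finset.exists_minimal hne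
    obtain ⟨hqQ, hqP⟩ := mem_sdiff.mp hq.prop
    have hqbox := hQQ.1 hqQ
    have hmin : ∀ r ∈ Q, ∀ s ∈ orb G q, r ≤ s → r ≠ s → r ∈ P := by
      intro r hr s hs hrs hne
      obtain ⟨g, hg, rfl⟩ := mem_orb.mp hs
      by_contra hrP
      have h1 : rot (-g) r ∈ Q \ P := by
        rw [mem_sdiff, hQ _ (G.neg_mem hg), hP _ (G.neg_mem hg)]
        exact ⟨hr, hrP⟩
      have h2 : rot (-g) r ≤ q := fun i => by
        have : r (i - g) ≤ rot g q (i - g) := hrs (i - g)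
        simpa [rot, sub_eq_add_neg] using this
      have h3 := le_antisymm h2 (hq.le_of_le h1 h2)
      apply hne
      rw [← h3, rot_rot, add_neg_cancel, rot_zero]
    have oQ := hQ.orb_subset hqQ
    have oP := fun r hr => hP.disjoint_orb hqP (q := r) hr
    have hq'Q : 1 - q ∉ Q := (hcmem hQc hqbox).mp hqQ
    have hq'P : 1 - q ∈ P := by
      by_contra h
      exact hqP ((hcmem hPc hqbox).mpr h)
    have oQ' := fun r hr => hQ.disjoint_orb hq'Q (q := r) hr
    have oP' := hP.orb_subset hq'P
    have hdisj : ∀ r, r ∈ orb G q → r ∉ orb G (1 - q) := fun r h h' => oQ' r h' (oQ h)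
    set P' := (P ∪ orb G q) \ orb G (1 - q) with hP'
    have hmem : ∀ r, r ∈ P' ↔ (r ∈ P ∨ r ∈ orb G q) ∧ r ∉ orb G (1 - q) := fun r => by
      rw [hP', mem_sdiff, mem_union]
    have hPP' : IsPP n P' := by
      constructor
      · intro r hr
        rcases ((hmem r).mp hr).1 with h | h
        · exact hPP.1 h
        · exact hQQ.1 (oQ h)
      · intro r hr s hs hsr
        rw [hmem] at hr ⊢
        constructor
        · rcases hr.1 with h | h
          · exact Or.inl (hPP.2 r h s hs hsr)
          · by_cases hsr' : s = r
            · rw [hsr']; exact Or.inr h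
            · exact Or.inl (hmin s (hQQ.2 r (oQ h) s hs hsr) r h hsr hsr')
        · intro hso
          have hso' : 1 - s ∈ orb G q := reflect_mem_orb.mpr hso
          rcases hr.1 with h | h
          · have hrbox := hPP.1 h
            have h1 : 1 - r ∉ P := (hcmem hPc hrbox).mp h
            have h2 : 1 - r ≤ 1 - s := sub_le_sub_left hsr 1
            have h3 := hQQ.2 _ (oQ hso') _ (reflect_mem_box.mpr hrbox) h2
            refine h1 (hmin _ h3 _ hso' h2 fun h4 => hr.2 ?_)
            rw [sub_right_injective h4]
            exact hso
          · exact oQ' s hso (hQQ.2 r (oQ h) s hs hsr)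
    have hPi : RotInv G P' := fun g hg r => by
      rw [hmem, hmem, hP g hg, rot_mem_orb hg, rot_mem_orb hg]
    have hPc' : compl n P' = P' := by
      ext r
      rw [mem_compl]
      constructor
      · rintro ⟨hr, h⟩
        rw [hmem, reflect_mem_orb, reflect_mem_orb, sub_sub_cancel] at h
        rw [hmem, hcmem hPc hr]
        have := hdisj r
        tauto
      · intro h
        have hr := hPP'.1 h
        refine ⟨hr, ?_⟩
        rw [hmem, hcmem hPc hr] at h
        rw [hmem, reflect_mem_orb, reflect_mem_orb, sub_sub_cancel]
        have := hdisj r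
        tauto
    have hcard : (Q \ P').card ≤ m := by
      have h1 : (Q \ P').card < (Q \ P).card := by
        refine card_lt_card ⟨fun r hr => ?_, fun h => ?_⟩
        · rw [mem_sdiff, hmem] at hr
          rw [mem_sdiff]
          exact ⟨hr.1, fun h => hr.2 ⟨Or.inl h, fun h' => oQ' r h' hr.1⟩⟩
        · have h2 := (mem_sdiff.mp (h hq.prop)).2
          rw [hmem] at h2
          exact h2 ⟨Or.inr (self_mem_orb q), hdisj q (self_mem_orb q)⟩
      omega
    -- On the main diagonal `q` and `1 - q` are comparable, so every self-complementary plane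
    -- partition contains the same half of it and `P`, `Q` cannot differ there.
    have hv0 : proj q ≠ 0 := by
      intro h
      have e0 := congrFun h 0
      have e1 := congrFun h 1
      simp [proj] at e0 e1
      rcases le_or_gt 1 (q 0) with hpos | hneg
      · refine hq'Q (hQQ.2 q hqQ _ (reflect_mem_box.mpr hqbox) fun i => ?_)
        obtain rfl | rfl | rfl := fin3_cases i <;> simp <;> omega
      · refine hqP (hPP.2 _ hq'P q hqbox fun i => ?_)
        obtain rfl | rfl | rfl := fin3_cases i <;> simp <;> omega
    have hneg : -proj q = proj (1 - q) := by rw [proj_sub, proj_one, zero_sub]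
    -- No rotation acts as the point reflection on a nonzero point, so the added and removed cubes
    -- lie on different diagonals.
    have hlines : ∀ r ∈ orb G q, ∀ s ∈ orb G (1 - q), proj r ≠ proj s := by
      intro r hr s hs h
      obtain ⟨g, hg, rfl⟩ := mem_orb.mp hr
      obtain ⟨g', hg', rfl⟩ := mem_orb.mp hs
      rw [← rot_proj, ← rot_proj, ← hneg, rot_neg] at h
      have h2 : rot (g - g') (rot g' (proj q)) = - rot g' (proj q) := by
        rw [rot_rot, sub_add_cancel, h]
      have h3 := eq_zero_of_rot_eq_neg (by rw [total_rot, total_proj]) h2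
      exact hv0 (rot_injective g' h3)
    obtain ⟨c₁, hc₁, hcc₁⟩ := exists_congr_flip hn hPP hP
      ((sec_mem_symMatchings_iff hn h0 hPP hP).mpr hPc) hPP' hPi
      ((sec_mem_symMatchings_iff hn h0 hPP' hPi).mpr hPc') (total_proj q) (interior_proj hqbox) hv0
      (fun x hx => by
        obtain ⟨r, hr, rfl⟩ := inOrb_proj_iff.mp hx
        refine ht_add_cube hPP hPP' (oP r hr) ((hmem r).mpr ⟨Or.inr hr, hdisj r hr⟩) fun s hs => ?_
        rw [hmem]
        constructor
        · rintro ⟨h | h, -⟩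
          · exact Or.inl h
          · exact Or.inr (eq_of_proj_eq hs ((total_of_mem_orb h).trans (total_of_mem_orb hr).symm))
        · intro h
          refine ⟨h.imp id fun e => by rw [e]; exact hr, fun h' => hlines r hr s h' hs.symm⟩)
      (fun x hx => by
        rw [hneg] at hx
        obtain ⟨r, hr, rfl⟩ := inOrb_proj_iff.mp hx
        refine ht_add_cube hPP' hPP (fun h => ((hmem r).mp h).2 hr) (oP' hr) fun s hs => ?_
        rw [hmem]
        constructor
        · intro h
          by_cases hso : s ∈ orb G (1 - q)
          · exact Or.inr (eq_of_proj_eq hs ((total_of_mem_orb hso).trans (total_of_mem_orb hr).symm))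
          · exact Or.inl ⟨Or.inl h, hso⟩
        · rintro (⟨h | h, -⟩ | rfl)
          · exact h
          · exact absurd hs (hlines s h r hr)
          · exact oP' hr)
      (fun x _ hx hx' => ht_congr fun s hs => by
        rw [hneg] at hx'
        have a1 : s ∉ orb G q := fun h => hx (inOrb_proj_iff.mpr ⟨s, h, hs⟩)
        have a2 : s ∉ orb G (1 - q) := fun h => hx' (inOrb_proj_iff.mpr ⟨s, h, hs⟩)
        rw [hmem]
        tauto)
    obtain ⟨c₂, hc₂, hcc₂⟩ := ih P' hPP' hPi hPc' hcard
    refine ⟨c₂ * c₁, by rw [Matrix.det_mul, hc₁, hc₂, one_mul], ?_⟩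
    rw [← hcc₂, ← hcc₁, Matrix.transpose_mul]
    simp only [Matrix.mul_assoc]

end BoxPP

/-! ### The determinant computed in two ways. -/

namespace BoxPP

open Finset

variable {G : AddSubgroup (Fin 3)} {n : Pt} {P Q : Finset Pt}

/-- `P` is a plane partition that is invariant under the rotations in `G`. -/
def IsInvPP (G : AddSubgroup (Fin 3)) (n : Pt) (P : Finset Pt) : Prop := IsPP n P ∧ RotInv G P

/-- `P` is a self-complementary plane partition that is invariant under the rotations in `G`. -/
def IsSelfComplInvPP (G : AddSubgroup (Fin 3)) (n : Pt) (P : Finset Pt) : Prop :=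
  IsInvPP G n P ∧ compl n P = P

open Classical in
/-- The plane partitions that are invariant under the rotations in `G`. -/
noncomputable def invPP (G : AddSubgroup (Fin 3)) (n : Pt) : Finset (Finset Pt) :=
  (Finset.Icc (1 - n) n).powerset.filter (IsInvPP G n)

open Classical in
/-- The self-complementary plane partitions that are invariant under the rotations in `G`. -/
noncomputable def selfComplInvPP (G : AddSubgroup (Fin 3)) (n : Pt) : Finset (Finset Pt) :=
  (Finset.Icc (1 - n) n).powerset.filter (IsSelfComplInvPP G n)

theorem mem_invPP : P ∈ invPP G n ↔ IsPP n P ∧ RotInv G P := by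
  simp only [invPP, mem_filter, mem_powerset]
  exact ⟨fun h => h.2, fun h => ⟨h.1.1, h⟩⟩

theorem mem_selfComplInvPP :
    P ∈ selfComplInvPP G n ↔ (IsPP n P ∧ RotInv G P) ∧ compl n P = P := by
  simp only [selfComplInvPP, mem_filter, mem_powerset]
  exact ⟨fun h => h.2, fun h => ⟨h.1.1.1, h⟩⟩

theorem abs_eq_sq_of_mul_eq_sq {s δ c : ℚ} (hδ : δ * δ = 1) (h : s * δ = c ^ 2) : |s| = c ^ 2 := by
  have hδ1 : |δ| = 1 := by
    rw [← abs_mul_abs_self] at hδ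
    nlinarith [abs_nonneg δ]
  rw [← h, ← abs_of_nonneg (h ▸ sq_nonneg c : 0 ≤ s * δ), abs_mul, hδ1, mul_one]

/-- The determinant is the signed count times the term `δ` of the empty plane partition, and also
the square of the number of symmetric matchings. Since `δ * δ = 1`, absolute values remove it. -/
theorem abs_sum_invPP (hn : BoxInv G n) (h0 : ∀ i, 0 ≤ n i) :
    |∑ P ∈ invPP G n, ∏ q ∈ P, cubeSign q| = ((selfComplInvPP G n).card : ℚ) ^ 2 := by
  have hE : RotInv G (∅ : Finset Pt) := fun g _ p => by simp
  set δ := ((net hn).secMat (sec G (isPP_empty n))).det with hδ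
  have hδ2 : δ * δ = 1 := SkewNet.det_secMat_mul_self (sec_mem_matchings hn (isPP_empty n) hE)
  have h1 : (net hn).adj.det = (∑ P ∈ invPP G n, ∏ q ∈ P, cubeSign q) * δ := by
    rw [SkewNet.det_adj, sum_mul]
    symm
    refine sum_bij (fun P hP => sec G (mem_invPP.mp hP).1) ?_ ?_ ?_ ?_
    · intro P hP
      exact sec_mem_matchings hn _ (mem_invPP.mp hP).2
    · intro P hP Q hQ h
      exact sec_injective hn _ (mem_invPP.mp hP).2 _ (mem_invPP.mp hQ).2 h
    · intro f hf
      obtain ⟨P, hPP, hP, rfl⟩ := sec_surjective hn hf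
      exact ⟨P, mem_invPP.mpr ⟨hPP, hP⟩, rfl⟩
    · intro P hP
      exact (det_secMat_sec hn _ P (mem_invPP.mp hP).1 (mem_invPP.mp hP).2 le_rfl).symm
  have hsurj : ∀ f ∈ (net hn).symMatchings, ∃ (P : Finset Pt) (hPP : IsPP n P), RotInv G P ∧
      compl n P = P ∧ sec G hPP = f := by
    intro f hf
    obtain ⟨P, hPP, hP, rfl⟩ := sec_surjective hn ((net hn).symMatchings_subset hf)
    exact ⟨P, hPP, hP, (sec_mem_symMatchings_iff hn h0 hPP hP).mp hf, rfl⟩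
  have h2 : (net hn).adj.det = ((net hn).symMatchings.card : ℚ) ^ 2 := by
    refine SkewNet.det_adj_eq_sq (net hn) fun f hf f' hf' => ?_
    obtain ⟨P, hPP, hP, hPc, rfl⟩ := hsurj f hf
    obtain ⟨Q, hQQ, hQ, hQc, rfl⟩ := hsurj f' hf'
    exact exists_congr_sec hn h0 hQQ hQ hQc _ P hPP hP hPc le_rfl
  have h3 : (selfComplInvPP G n).card = (net hn).symMatchings.card := by
    refine card_bij (fun P hP => sec G (mem_selfComplInvPP.mp hP).1.1) ?_ ?_ ?_
    · intro P hP
      obtain ⟨h, hc⟩ := mem_selfComplInvPP.mp hP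
      exact (sec_mem_symMatchings_iff hn h0 _ h.2).mpr hc
    · intro P hP Q hQ h
      exact sec_injective hn _ (mem_selfComplInvPP.mp hP).1.2 _ (mem_selfComplInvPP.mp hQ).1.2 h
    · intro f hf
      obtain ⟨P, hPP, hP, hPc, rfl⟩ := hsurj f hf
      exact ⟨P, mem_selfComplInvPP.mpr ⟨⟨hPP, hP⟩, hPc⟩, rfl⟩
  rw [h3]
  exact abs_eq_sq_of_mul_eq_sq hδ2 (h1.symm.trans h2)

end BoxPP

/-! ### Translation between the box of positive integers and the centred box. -/

namespace BoxPP

open Finset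

/-- The half-dimensions of the box as an integer vector. -/
def halfDim (a b c : ℕ) : Pt := ![(a : ℤ), b, c]

/-- The coordinates of a cube relative to the centre of the box. -/
def centre (a b c : ℕ) : ℕ × ℕ × ℕ ↪ Pt where
  toFun p := ![(p.1 : ℤ) - a, (p.2.1 : ℤ) - b, (p.2.2 : ℤ) - c]
  inj' p q h := by
    have h0 := congrFun h 0
    have h1 := congrFun h 1
    have h2 := congrFun h 2
    simp at h0 h1 h2
    exact Prod.ext h0 (Prod.ext h1 h2)

section

variable {a b c : ℕ} {P : Finset (ℕ × ℕ × ℕ)}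

theorem centre_apply (p : ℕ × ℕ × ℕ) : centre a b c p 0 = (p.1 : ℤ) - a ∧
    centre a b c p 1 = (p.2.1 : ℤ) - b ∧ centre a b c p 2 = (p.2.2 : ℤ) - c := ⟨rfl, rfl, rfl⟩

theorem pt_forall {p : Fin 3 → Prop} : (∀ i, p i) ↔ p 0 ∧ p 1 ∧ p 2 := by
  constructor
  · intro h
    exact ⟨h 0, h 1, h 2⟩
  · rintro ⟨h0, h1, h2⟩ i
    obtain rfl | rfl | rfl := fin3_cases i <;> assumption

theorem mem_box_iff {p : ℕ × ℕ × ℕ} : p ∈ box (2 * a) (2 * b) (2 * c) ↔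
    centre a b c p ∈ Finset.Icc (1 - halfDim a b c) (halfDim a b c) := by
  rw [mem_box, pt_forall, (centre_apply p).1, (centre_apply p).2.1, (centre_apply p).2.2]
  simp only [box, mem_product, Finset.mem_Icc, halfDim, Matrix.cons_val]
  omega

theorem exists_centre_eq {q : Pt} (hq : q ∈ Finset.Icc (1 - halfDim a b c) (halfDim a b c)) :
    ∃ p, centre a b c p = q := by
  rw [mem_box, pt_forall] at hq
  simp only [halfDim, Matrix.cons_val] at hq
  refine ⟨((q 0 + a).toNat, (q 1 + b).toNat, (q 2 + c).toNat), pt_ext ?_ ?_ ?_⟩ <;>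
    simp only [(centre_apply _).1, (centre_apply _).2.1, (centre_apply _).2.2] <;> omega

theorem centre_le_centre {p q : ℕ × ℕ × ℕ} : centre a b c p ≤ centre a b c q ↔ p ≤ q := by
  rw [Pi.le_def, pt_forall, (centre_apply p).1, (centre_apply p).2.1, (centre_apply p).2.2,
    (centre_apply q).1, (centre_apply q).2.1, (centre_apply q).2.2, Prod.le_def, Prod.le_def]
  omega

theorem exists_map_eq {Q : Finset Pt} (hQ : Q ⊆ Finset.Icc (1 - halfDim a b c) (halfDim a b c)) :
    ∃ P, P ⊆ box (2 * a) (2 * b) (2 * c) ∧ P.map (centre a b c) = Q := by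
  refine ⟨(box (2 * a) (2 * b) (2 * c)).filter fun p => centre a b c p ∈ Q, filter_subset _ _, ?_⟩
  ext q
  simp only [mem_map, mem_filter]
  constructor
  · rintro ⟨p, ⟨-, h⟩, rfl⟩
    exact h
  · intro h
    obtain ⟨p, rfl⟩ := exists_centre_eq (hQ h)
    exact ⟨p, ⟨mem_box_iff.mpr (hQ h), h⟩, rfl⟩

theorem map_subset_iff : P.map (centre a b c) ⊆ Finset.Icc (1 - halfDim a b c) (halfDim a b c) ↔
    P ⊆ box (2 * a) (2 * b) (2 * c) := by
  simp only [Finset.subset_iff, mem_map, mem_box_iff, forall_exists_index, and_imp,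
    forall_apply_eq_imp_iff₂]

theorem isPP_map_iff :
    IsPP (halfDim a b c) (P.map (centre a b c)) ↔ IsPlanePartition (2 * a) (2 * b) (2 * c) P := by
  unfold IsPP IsPlanePartition
  rw [map_subset_iff]
  refine and_congr_right fun _ => ?_
  constructor
  · intro h p hp q hq hqp
    simpa using h _ (mem_map_of_mem _ hp) (centre a b c q) (mem_box_iff.mp hq)
      (centre_le_centre.mpr hqp)
  · intro h p hp q hq hqp
    obtain ⟨p, hpP, rfl⟩ := mem_map.mp hp
    obtain ⟨q, rfl⟩ := exists_centre_eq hq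
    exact mem_map_of_mem _ (h p hpP q (mem_box_iff.mpr hq) (centre_le_centre.mp hqp))

theorem mem_planePartitions : P ∈ planePartitions (2 * a) (2 * b) (2 * c) ↔
    IsPP (halfDim a b c) (P.map (centre a b c)) := by
  simp only [planePartitions, mem_filter, mem_powerset, isPP_map_iff]
  exact ⟨fun h => h.2, fun h => ⟨h.1, h⟩⟩

theorem rot_centre (x y z : ℕ) : rot 1 (centre a a a (x, y, z)) = centre a a a (y, z, x) := by
  refine pt_ext ?_ ?_ ?_ <;> rfl

theorem rotInv_top_map_iff :
    RotInv ⊤ (P.map (centre a a a)) ↔ IsCyclicallySymmetric P := by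
  constructor
  · intro h x y z
    have := h 1 trivial (centre a a a (x, y, z))
    rw [rot_centre, mem_map', mem_map'] at this
    exact this.symm
  · intro h
    have h1 : ∀ p, p ∈ P.map (centre a a a) → rot 1 p ∈ P.map (centre a a a) := by
      intro p hp
      obtain ⟨⟨x, y, z⟩, hpP, rfl⟩ := mem_map.mp hp
      rw [rot_centre, mem_map']
      exact (h x y z).mp hpP
    have h2 : ∀ p, rot 1 p ∈ P.map (centre a a a) ↔ p ∈ P.map (centre a a a) := by
      intro p
      refine ⟨fun hp => ?_, h1 p⟩
      have := h1 _ (h1 _ hp)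
      rwa [rot_rot, rot_rot, show (1 : Fin 3) + 1 + 1 = 0 by rfl, rot_zero] at this
    intro g _ p
    obtain rfl | rfl | rfl := fin3_cases g
    · rw [rot_zero]
    · exact h2 p
    · rw [show (2 : Fin 3) = 1 + 1 by rfl, ← rot_rot, h2, h2]

theorem compl_map_iff (hP : P ⊆ box (2 * a) (2 * b) (2 * c)) :
    compl (halfDim a b c) (P.map (centre a b c)) = P.map (centre a b c) ↔
      IsSelfComplementary (2 * a) (2 * b) (2 * c) P := by
  have hrefl : ∀ x y z, (x, y, z) ∈ box (2 * a) (2 * b) (2 * c) → 1 - centre a b c (x, y, z) =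
      centre a b c (2 * a + 1 - x, 2 * b + 1 - y, 2 * c + 1 - z) := by
    intro x y z h
    simp only [box, mem_product, Finset.mem_Icc] at h
    refine pt_ext ?_ ?_ ?_ <;> simp only [Pi.sub_apply, Pi.one_apply, (centre_apply _).1,
      (centre_apply _).2.1, (centre_apply _).2.2] <;> omega
  rw [Finset.ext_iff]
  constructor
  · intro h x y z hb
    have := h (centre a b c (x, y, z))
    rw [mem_compl, hrefl x y z hb, mem_map', mem_map', ← mem_box_iff] at this
    rw [← this]
    exact and_iff_right hb
  · intro h q
    rw [mem_compl]
    constructor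
    · rintro ⟨hq, hq'⟩
      obtain ⟨⟨x, y, z⟩, rfl⟩ := exists_centre_eq hq
      rw [← mem_box_iff] at hq
      rw [hrefl x y z hq, mem_map'] at hq'
      rw [mem_map']
      exact (h x y z hq).mpr hq'
    · intro hq
      obtain ⟨⟨x, y, z⟩, hqP, rfl⟩ := mem_map.mp hq
      rw [← mem_box_iff, hrefl x y z (hP hqP), mem_map']
      exact ⟨hP hqP, (h x y z (hP hqP)).mp hqP⟩

end

theorem halfDim_nonneg (a b c : ℕ) (i : Fin 3) : 0 ≤ halfDim a b c i := by
  obtain rfl | rfl | rfl := fin3_cases i <;> simp [halfDim]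

theorem boxInv_bot (n : Pt) : BoxInv ⊥ n := by
  intro g hg i
  rw [AddSubgroup.mem_bot] at hg
  rw [hg, add_zero]

theorem boxInv_top (a : ℕ) : BoxInv ⊤ (halfDim a a a) := by
  have : ∀ i, halfDim a a a i = a := fun i => by
    obtain rfl | rfl | rfl := fin3_cases i <;> simp [halfDim]
  intro g _ i
  rw [this, this]

theorem rotInv_bot (P : Finset Pt) : RotInv ⊥ P := by
  intro g hg p
  rw [AddSubgroup.mem_bot] at hg
  rw [hg, rot_zero]

theorem proj_eq_zero_iff {p : Pt} : proj p = 0 ↔ p 0 = p 1 ∧ p 1 = p 2 := by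
  constructor
  · intro h
    have h0 := congrFun h 0
    have h2 := congrFun h 2
    simp [proj] at h0 h2
    omega
  · rintro ⟨h0, h1⟩
    refine pt_ext ?_ ?_ ?_ <;> simp [proj] <;> omega

theorem cast_N1 (a b c : ℕ) : ((N1 a b c (-1) 1 : ℤ) : ℚ) =
    ∑ P ∈ invPP ⊥ (halfDim a b c), ∏ q ∈ P, cubeSign q := by
  rw [N1, Int.cast_sum]
  refine sum_bij (fun P _ => P.map (centre a b c)) ?_ ?_ ?_ ?_
  · intro P hP
    exact mem_invPP.mpr ⟨mem_planePartitions.mp hP, rotInv_bot _⟩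
  · intro P _ Q _ h
    exact map_injective _ h
  · intro Q hQ
    have h := (mem_invPP.mp hQ).1
    obtain ⟨P, -, rfl⟩ := exists_map_eq h.1
    exact ⟨P, mem_planePartitions.mpr h, rfl⟩
  · intro P _
    rw [prod_map, Int.cast_prod]
    refine prod_congr rfl fun p _ => ?_
    have : (∃ i : ℤ, (p.1 : ℤ) = a + i ∧ (p.2.1 : ℤ) = b + i ∧ (p.2.2 : ℤ) = c + i) ↔
        proj (centre a b c p) = 0 := by
      rw [proj_eq_zero_iff, (centre_apply p).1, (centre_apply p).2.1, (centre_apply p).2.2]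
      constructor
      · rintro ⟨i, h0, h1, h2⟩
        omega
      · rintro ⟨h0, h1⟩
        exact ⟨p.1 - a, by omega, by omega, by omega⟩
    simp only [this, cubeSign]
    split_ifs <;> simp

theorem N5_eq (a b c : ℕ) :
    N5 (2 * a) (2 * b) (2 * c) = (selfComplInvPP ⊥ (halfDim a b c)).card := by
  refine card_bij (fun P _ => P.map (centre a b c)) ?_ ?_ ?_
  · intro P hP
    simp only [mem_filter] at hP
    obtain ⟨h1, h2⟩ := hP
    have h3 := mem_planePartitions.mp h1
    exact mem_selfComplInvPP.mpr ⟨⟨h3, rotInv_bot _⟩, (compl_map_iff (map_subset_iff.mp h3.1)).mpr h2⟩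
  · intro P _ Q _ h
    exact map_injective _ h
  · intro Q hQ
    obtain ⟨⟨h1, -⟩, h2⟩ := mem_selfComplInvPP.mp hQ
    obtain ⟨P, hP, rfl⟩ := exists_map_eq h1.1
    refine ⟨P, ?_, rfl⟩
    simp only [mem_filter]
    exact ⟨mem_planePartitions.mpr h1, (compl_map_iff hP).mp h2⟩

theorem cast_N3 (a : ℕ) : ((N3 (2 * a) (-1) 1 1 : ℤ) : ℚ) =
    ∑ P ∈ invPP ⊤ (halfDim a a a), ∏ q ∈ P, cubeSign q := by
  rw [N3, Int.cast_sum]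
  refine sum_bij (fun P _ => P.map (centre a a a)) ?_ ?_ ?_ ?_
  · intro P hP
    simp only [mem_filter] at hP
    obtain ⟨h1, h2⟩ := hP
    exact mem_invPP.mpr ⟨mem_planePartitions.mp h1, rotInv_top_map_iff.mpr h2⟩
  · intro P _ Q _ h
    exact map_injective _ h
  · intro Q hQ
    obtain ⟨h1, h2⟩ := mem_invPP.mp hQ
    obtain ⟨P, -, rfl⟩ := exists_map_eq h1.1
    refine ⟨P, ?_, rfl⟩
    simp only [mem_filter]
    exact ⟨mem_planePartitions.mpr h1, rotInv_top_map_iff.mp h2⟩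
  · intro P _
    rw [prod_map, Int.cast_prod]
    refine prod_congr rfl fun p _ => ?_
    have : (p.1 = p.2.1 ∧ p.2.1 = p.2.2) ↔ proj (centre a a a p) = 0 := by
      rw [proj_eq_zero_iff, (centre_apply p).1, (centre_apply p).2.1, (centre_apply p).2.2]
      omega
    -- The two off-diagonal classes of cubes both have weight `1`, so they merge.
    simp only [this, cubeSign, ite_self]
    split_ifs <;> simp

theorem N9_eq (a : ℕ) : N9 (2 * a) = (selfComplInvPP ⊤ (halfDim a a a)).card := by
  refine card_bij (fun P _ => P.map (centre a a a)) ?_ ?_ ?_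
  · intro P hP
    simp only [mem_filter] at hP
    obtain ⟨h1, h2, h3⟩ := hP
    have h4 := mem_planePartitions.mp h1
    exact mem_selfComplInvPP.mpr
      ⟨⟨h4, rotInv_top_map_iff.mpr h2⟩, (compl_map_iff (map_subset_iff.mp h4.1)).mpr h3⟩
  · intro P _ Q _ h
    exact map_injective _ h
  · intro Q hQ
    obtain ⟨⟨h1, h2⟩, h3⟩ := mem_selfComplInvPP.mp hQ
    obtain ⟨P, hP, rfl⟩ := exists_map_eq h1.1
    refine ⟨P, ?_, rfl⟩
    simp only [mem_filter]
    exact ⟨mem_planePartitions.mpr h1, rotInv_top_map_iff.mp h2,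
      (compl_map_iff hP).mp h3⟩

end BoxPP

theorem mainTheorem5 :
    (∀ a b c : ℕ, |BoxPP.N1 a b c (-1) 1| = (BoxPP.N5 (2 * a) (2 * b) (2 * c) : ℤ) ^ 2) ∧
    (∀ a : ℕ, |BoxPP.N3 (2 * a) (-1) 1 1| = (BoxPP.N9 (2 * a) : ℤ) ^ 2) := by
  constructor
  · intro a b c
    have h := BoxPP.abs_sum_invPP (BoxPP.boxInv_bot _) (BoxPP.halfDim_nonneg a b c)
    rw [← BoxPP.cast_N1, ← BoxPP.N5_eq] at h
    exact_mod_cast h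
  · intro a
    have h := BoxPP.abs_sum_invPP (BoxPP.boxInv_top a) (BoxPP.halfDim_nonneg a a a)
    rw [← BoxPP.cast_N3, ← BoxPP.N9_eq] at h
    exact_mod_cast h
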